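/- Let $(X,\rho)$ be a complete separable metric space with its Borel $\sigma$-field. Let $\{P_t\}_{t\ge 0}$ be a Markov semigroup of stochastic kernels on $X$, that is: each $P_t$ is a stochastic kernel, $(t,x)\mapsto P_t(x,A)$ is jointly measurable for every Borel set $A$, $P_0(x,\cdot)=\delta_x$ and $P_{s+t}=P_sP_t$. As usual, $P_tf(x)=\int_X f\,dP_t(x,\cdot)$ and $\nu P_t(A)=\int_X P_t(x,A)\,\nu(dx)$. Let $\Phi=(\Omega,\mathcal F,\{\mathcal F_t\}_{t\ge0},\{\Phi_t\}_{t\ge 0},\{\theta_t\}_{t\ge0},\{\mathbb P_x\}_{x\in X})$ be a time-homogeneous Markov process with state space $X$ and transition semigroup $\{P_t\}_{t\ge 0}$, where $\mathcal F=\sigma(\Phi_s:s\ge 0)$ and $\mathcal F_t=\sigma(\Phi_s: s\le t)$; that is, each $\mathbb P_x$ is a probability measure on $\mathcal F$, $\theta_t:\Omega\to\Omega$, and for all $s,t\ge0$, $x\in X$ and Borel sets $A$: $\Phi_{s+t}=\Phi_s\circ\theta_t$, $\mathbb P_x(\Phi_0=x)=1$, $\mathbb P_x(\Phi_{t+s}\in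 A\mid\mathcal F_s)=\mathbb P_{\Phi_s}(\Phi_t\in A)$ $\mathbb P_x$-a.s., and $\mathbb P_x(\Phi_t\in A)=P_t(x,A)$. Suppose also that $\Phi$ is progressively measurable. Write $\mathbb E_x$ for the expectation under $\mathbb P_x$. For $r>0$ let $\mathcal M_{1,r}(X)$ be the set of Borel probability measures $\nu$ on $X$ with $\int_X\rho(x_0,x)^r\,\nu(dx)<\infty$ for some $x_0\in X$, and for $\nu_1,\nu_2\in\mathcal M_{1,1}(X)$ let $d_W(\nu_1,\nu_2)=\sup\{|\int f\,d\nu_1-\int f\,d\nu_2| : \operatorname{Lip} f\le 1\}$ be the Wasserstein distance. Assume that: (A1) $\lim_{t\to0^+}P_tf(x)=f(x)$ for all $x\in X$ and all bounded continuous $f:X\to\mathbb R$; (A2) $P_tf$ is bounded and continuous for every bounded continuous $f:X\to\mathbb R$ and every $t\ge 0$; (A3) $\nu P_t\in\mathcal M_{1,1}(X)$ for all $\nu\in\mathcal M_{1,1}(X)$ and $t>0$, and there is $\gamma>0$ such that $d_W(\delta_xP_t,\delta_yP_t)\le e^{-\gamma t}\rho(x,y)$ for all $t\ge0$ and $x,y\in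 X$; (A4) there are a Borel probability measure $\mu$ on $X$, a point $x_0\in X$ and $\zeta>2$ such that $\sup_{t\ge 0}\int_X\rho(x_0,x)^\zeta\,(\mu P_t)(dx)<\infty$. Let $\mu_*$ be the invariant probability measure of $\{P_t\}_{t\ge0}$ (under these assumptions it exists and is unique), and let $g:X\to\mathbb R$ be a bounded Lipschitz function with $\int_X g\,d\mu_*=0$. Put $$\chi_g(x)=\int_0^\infty P_tg(x)\,dt\quad(x\in X),\qquad Z_n=\chi_g(\Phi_n)-\chi_g(\Phi_{n-1})+\int_{n-1}^n g(\Phi_s)\,ds\quad(n\ge1).$$ Then for every $p\in\mathbb N\cup\{\infty\}$, every $d\in[0,\infty)$ and each $i\in\{0,1\}$, the functions $\mathcal I,\mathcal S:X\to[0,1]$ given by $$\mathcal I(x)=\mathbb E_x\left[\left|\liminf_{n\to\infty}\frac1n\sum_{k=1}^n\left(Z_{2k+i}^2\wedge p\right)-d\right|\wedge1\right],\qquad \mathcal S(x)=\mathbb E_x\left[\left|\limsup_{n\to\infty}\frac1n\sum_{k=1}^n\left(Z_{2k+i}^2\wedge p\right)-d\right|\wedge1\right]$$ are continuous on $X$.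 (Here the lower and upper limits are taken in $[0,\infty]$, with $|\infty-d|\wedge 1=1$.) -/

import Mathlib

open MeasureTheory ProbabilityTheory Filter Topology
open scoped NNReal ENNReal BoundedContinuousFunction

noncomputable section

namespace MarkovLIL

variable {X : Type*} [MetricSpace X] [MeasurableSpace X]
variable {Ω : Type*}

/-- A Markov semigroup of stochastic kernels on `X`, indexed by the time set `[0, ∞)`. The kernel
`P_s P_t` (first a transition by `P_s`, then one by `P_t`) is `P t ∘ₖ P s` in Mathlib's notation. -/
structure IsMarkovSemigroup (P : ℝ≥0 → Kernel X X) : Prop where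
  stochastic : ∀ t, IsMarkovKernel (P t)
  jointly_measurable : ∀ A : Set X, MeasurableSet A →
    Measurable (fun q : ℝ≥0 × X => P q.1 q.2 A)
  zero : ∀ x, P 0 x = Measure.dirac x
  add : ∀ s t, P (s + t) = P t ∘ₖ P s

/-- The `σ`-field `𝓕_t = σ(Φ_s : s ≤ t)` of the natural filtration. -/
abbrev past (Φ : ℝ≥0 → Ω → X) (t : ℝ≥0) : MeasurableSpace Ω :=
  ⨆ s : Set.Iic t, MeasurableSpace.comap (Φ s) inferInstance

/-- The `σ`-field `𝓕_∞ = σ(Φ_s : s ≥ 0)`. -/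
abbrev wholePast (Φ : ℝ≥0 → Ω → X) : MeasurableSpace Ω :=
  ⨆ s : ℝ≥0, MeasurableSpace.comap (Φ s) inferInstance

/-- A time-homogeneous Markov process `(Ω, 𝓕, (𝓕_t), (Φ_t), (θ_t), (Pr_x))` with state space `X` and
transition semigroup `P`, considered with `𝓕 = σ(Φ_s : s ≥ 0)` and with its natural filtration, and
progressively measurable. Adaptedness of `Φ` is automatic for the natural filtration. -/
structure IsProgMarkovProcess [mΩ : MeasurableSpace Ω] (P : ℝ≥0 → Kernel X X)
    (Φ : ℝ≥0 → Ω → X) (θ : ℝ≥0 → Ω → Ω) (Pr : X → Measure Ω) : Prop where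
  sigma_eq : mΩ = wholePast Φ
  prob : ∀ x, IsProbabilityMeasure (Pr x)
  shift : ∀ s t ω, Φ (s + t) ω = Φ s (θ t ω)
  start : ∀ x, ∀ᵐ ω ∂(Pr x), Φ 0 ω = x
  markov : ∀ (x : X) (A : Set X), MeasurableSet A → ∀ s t : ℝ≥0,
    (Pr x)[(Φ (t + s) ⁻¹' A).indicator (fun _ => (1 : ℝ)) | past Φ s]
      =ᵐ[Pr x] fun ω => (Pr (Φ s ω)).real (Φ t ⁻¹' A)
  transition : ∀ (x : X) (A : Set X), MeasurableSet A → ∀ t : ℝ≥0,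
    Pr x (Φ t ⁻¹' A) = P t x A
  progressive : ∀ t : ℝ≥0,
    Measurable[MeasurableSpace.prod inferInstance (past Φ t)]
      (fun q : Set.Iic t × Ω => Φ q.1 q.2)

/-- `ν ∈ 𝓜_{1,r}(X)`: a probability measure with finite `r`-th moment. -/
def HasFiniteMoment (r : ℝ) (ν : Measure X) : Prop :=
  IsProbabilityMeasure ν ∧ ∃ x₀ : X, ∫⁻ x, ENNReal.ofReal (dist x₀ x ^ r) ∂ν < ∞

/-- The Wasserstein distance, as a supremum over the functions with Lipschitz constant at most `1`
(with values in `[0, ∞]`; only used for measures with finite first moment). -/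
def wassersteinDist (μ ν : Measure X) : ℝ≥0∞ :=
  ⨆ (f : X → ℝ) (_ : LipschitzWith 1 f), ENNReal.ofReal |(∫ x, f x ∂μ) - ∫ x, f x ∂ν|

/-- `P_t f → f` pointwise as `t → 0⁺`, for bounded continuous `f`. -/
def StochasticallyContinuous (P : ℝ≥0 → Kernel X X) : Prop :=
  ∀ (f : X →ᵇ ℝ) (x : X), Tendsto (fun t : ℝ≥0 => ∫ y, f y ∂(P t x)) (𝓝[>] 0) (𝓝 (f x))

/-- `P_t` maps bounded continuous functions to (bounded) continuous functions. -/
def Feller (P : ℝ≥0 → Kernel X X) : Prop :=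
  ∀ (t : ℝ≥0) (f : X →ᵇ ℝ), Continuous (fun x => ∫ y, f y ∂(P t x))

/-- Exponential mixing in the Wasserstein distance, with multiplicative constant `1`.
Here `ν.bind (P t)` is the measure `ν P_t`, and `P t x` is `δ_x P_t`. -/
def ExponentiallyMixing (P : ℝ≥0 → Kernel X X) : Prop :=
  (∀ ν : Measure X, HasFiniteMoment 1 ν → ∀ t : ℝ≥0, 0 < t → HasFiniteMoment 1 (ν.bind (P t))) ∧
  ∃ γ : ℝ, 0 < γ ∧ ∀ (t : ℝ≥0) (x y : X),
    wassersteinDist (P t x) (P t y) ≤ ENNReal.ofReal (Real.exp (-γ * t) * dist x y)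

/-- For some `x₀` and some `ζ > 2`, the `ζ`-th moments about `x₀` of the measures `μ P_t`, `t ≥ 0`,
are bounded. -/
def UniformlyBoundedMoment (P : ℝ≥0 → Kernel X X) (μ : Measure X) : Prop :=
  ∃ (x₀ : X) (ζ : ℝ), 2 < ζ ∧
    ⨆ t : ℝ≥0, ∫⁻ x, ENNReal.ofReal (dist x₀ x ^ ζ) ∂(μ.bind (P t)) < ∞

/-- The measure `μ` is invariant: `μ P_t = μ` for all `t`. -/
def IsInvariant (P : ℝ≥0 → Kernel X X) (μ : Measure X) : Prop :=
  ∀ t : ℝ≥0, μ.bind (P t) = μ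

/-- The corrector `χ_g(x) = ∫₀^∞ P_t g(x) dt`. -/
def corrector (P : ℝ≥0 → Kernel X X) (g : X → ℝ) (x : X) : ℝ :=
  ∫ t in Set.Ioi (0 : ℝ), ∫ y, g y ∂(P t.toNNReal x)

/-- The martingale increment
`Z_n = χ_g(Φ_n) - χ_g(Φ_{n-1}) + ∫_{n-1}^n g(Φ_s) ds` (only meaningful, and only used, for `n ≥ 1`). -/
def increment (P : ℝ≥0 → Kernel X X) (Φ : ℝ≥0 → Ω → X) (g : X → ℝ) (n : ℕ) (ω : Ω) : ℝ :=
  corrector P g (Φ (n : ℝ≥0) ω) - corrector P g (Φ ((n - 1 : ℕ) : ℝ≥0) ω)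
    + ∫ s in ((n : ℝ) - 1)..(n : ℝ), g (Φ s.toNNReal ω)

/-- The average `(1/n) ∑_{k=1}^n (Z_{2k+i}² ∧ p)`, as an element of `[0, ∞]`. -/
def truncAverage (P : ℝ≥0 → Kernel X X) (Φ : ℝ≥0 → Ω → X) (g : X → ℝ) (i : ℕ) (p : ℕ∞)
    (n : ℕ) (ω : Ω) : ℝ≥0∞ :=
  (∑ k ∈ Finset.Icc 1 n,
    min (ENNReal.ofReal (increment P Φ g (2 * k + i) ω ^ 2)) (p : ℝ≥0∞)) / n

/-- The number `|L - d| ∧ 1` for `L ∈ [0, ∞]` and real `d`, where `|∞ - d| = ∞`. -/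
def truncDist (L : ℝ≥0∞) (d : ℝ) : ℝ :=
  if L = ∞ then 1 else min |L.toReal - d| 1

/-- `x ↦ 𝔼_x [ |liminf_n (1/n) ∑_{k=1}^n (Z_{2k+i}² ∧ p) - d| ∧ 1 ]`. -/
def liminfFun (P : ℝ≥0 → Kernel X X) [MeasurableSpace Ω] (Φ : ℝ≥0 → Ω → X) (Pr : X → Measure Ω)
    (g : X → ℝ) (i : ℕ) (p : ℕ∞) (d : ℝ) (x : X) : ℝ :=
  ∫ ω, truncDist (liminf (fun n : ℕ => truncAverage P Φ g i p n ω) atTop) d ∂(Pr x)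

/-- `x ↦ 𝔼_x [ |limsup_n (1/n) ∑_{k=1}^n (Z_{2k+i}² ∧ p) - d| ∧ 1 ]`. -/
def limsupFun (P : ℝ≥0 → Kernel X X) [MeasurableSpace Ω] (Φ : ℝ≥0 → Ω → X) (Pr : X → Measure Ω)
    (g : X → ℝ) (i : ℕ) (p : ℕ∞) (d : ℝ) (x : X) : ℝ :=
  ∫ ω, truncDist (limsup (fun n : ℕ => truncAverage P Φ g i p n ω) atTop) d ∂(Pr x)

end MarkovLIL

end

/-! Both functions are Lipschitz, with constant `2 * √(d + 1) * (2K/γ + K) / (1 - exp (-γ))` where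
`K` is a Lipschitz constant of `g`.

The probabilistic half bounds how much the law of the increments depends on the starting point. If a
functional of finitely many positions has Lipschitz weight `l j` in the position at time `t j`, then
integrating out the last position by the Markov property moves its weight to the previous time,
multiplied by `exp (-γ * τ)` for the time gap `τ`. Iterating down to time `0` gives the Lipschitz
constant `∑ l j * exp (-γ * t j)` for the expectation (`abs_integral_path_sub_le`). The corrector is
`K/γ`-Lipschitz, and the integral in an increment is a limit in mean of Riemann sums, so the
increment over `[m, m + 1]` has total damped weight at most `(2K/γ + K) * exp (-γ * m)`. The
geometric series gives a bound that does not depend on the number of increments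
(`abs_integral_increments_sub_le`).

The deterministic half shows that the functional is Lipschitz for the `ℓ¹` distance of increment
sequences. The square root of an average of truncated squares is a normalised `ℓ²` norm, so by
Minkowski it moves by at most the `ℓ¹` distance `δ`. The relation "square roots differ by at most
`δ`" passes to finite minima and maxima, and `|L - d| ∧ 1` sees only `L ≤ d + 1`, where it costs the
factor `2 * √(d + 1)`. Lower and upper limits are iterated limits of finite minima and maxima, and
the uniform bound survives both limits by dominated convergence. -/

namespace MarkovLIL

set_option linter.unusedSectionVars false

/-! ### Dependence of path functionals on the starting point -/

section PathLipschitz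

variable {X : Type*} [MetricSpace X] [MeasurableSpace X]
  {Ω : Type*} [mΩ : MeasurableSpace Ω]
  {P : ℝ≥0 → Kernel X X} {Φ : ℝ≥0 → Ω → X} {θ : ℝ≥0 → Ω → Ω} {Pr : X → Measure Ω} {γ : ℝ}

lemma abs_integral_le_of_abs_le {E : Type*} [MeasurableSpace E] (ν : Measure E)
    [IsProbabilityMeasure ν] {f : E → ℝ} {B : ℝ} (hf : ∀ e, |f e| ≤ B) : |∫ e, f e ∂ν| ≤ B := by
  simpa using norm_integral_le_of_norm_le_const (μ := ν) (f := f) (C := B) (ae_of_all _ hf)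

/-- `D` need not be a metric. It will be a weighted distance in finitely many coordinates of a
sequence space, which is continuous for the product topology. -/
lemma measurable_of_abs_sub_le {E : Type*} [TopologicalSpace E] [MeasurableSpace E]
    [OpensMeasurableSpace E] {H : E → ℝ} {D : E → E → ℝ} (hD : ∀ v, Continuous fun u => D u v)
    (hD0 : ∀ v, D v v = 0) (hH : ∀ u v, |H u - H v| ≤ D u v) : Measurable H := by
  refine Continuous.measurable (continuous_iff_continuousAt.2 fun v => ?_)
  rw [ContinuousAt, tendsto_iff_dist_tendsto_zero]
  refine squeeze_zero (fun _ => dist_nonneg) (fun u => hH u v) ?_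
  simpa [hD0] using (hD v).tendsto v

lemma abs_integral_sub_le_of_wassersteinDist_le
    (hγ : ∀ (t : ℝ≥0) (x y : X),
      wassersteinDist (P t x) (P t y) ≤ ENNReal.ofReal (Real.exp (-γ * t) * dist x y))
    {f : X → ℝ} {L : ℝ} (hL : 0 ≤ L) (hf : ∀ u v, |f u - f v| ≤ L * dist u v)
    (t : ℝ≥0) (x y : X) :
    |(∫ u, f u ∂(P t x)) - ∫ u, f u ∂(P t y)| ≤ L * (Real.exp (-γ * t) * dist x y) := by
  have pos : ∀ L : ℝ, 0 < L → (∀ u v, |f u - f v| ≤ L * dist u v) →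
      |(∫ u, f u ∂(P t x)) - ∫ u, f u ∂(P t y)| ≤ L * (Real.exp (-γ * t) * dist x y) := by
    intro L hL hf
    have hlip : LipschitzWith 1 (fun u => L⁻¹ * f u) := by
      refine LipschitzWith.of_dist_le_mul fun u v => ?_
      rw [Real.dist_eq, ← mul_sub, abs_mul, abs_of_pos (inv_pos.2 hL), NNReal.coe_one, one_mul,
        inv_mul_le_iff₀ hL]
      exact hf u v
    have h := le_iSup₂_of_le (f := fun (f : X → ℝ) (_ : LipschitzWith 1 f) =>
      ENNReal.ofReal |(∫ x, f x ∂(P t x)) - ∫ x, f x ∂(P t y)|) _ hlip le_rfl |>.trans (hγ t x y)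
    rw [ENNReal.ofReal_le_ofReal_iff (by positivity), integral_const_mul, integral_const_mul,
      ← mul_sub, abs_mul, abs_of_pos (inv_pos.2 hL), inv_mul_le_iff₀ hL] at h
    exact h
  rcases hL.eq_or_lt with rfl | hL
  -- For `L = 0` rescaling by `L⁻¹` is impossible, so the positive case is used with arbitrarily
  -- small constants.
  · refine le_of_forall_pos_le_add fun ε hε => ?_
    set c := Real.exp (-γ * t) * dist x y
    have hc : 0 ≤ c := by positivity
    have h := pos (ε / (c + 1)) (by positivity) fun u v => (hf u v).trans (by
      rw [zero_mul]; positivity)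
    refine h.trans ?_
    rw [zero_mul, zero_add, div_mul_eq_mul_div, div_le_iff₀ (by positivity)]
    nlinarith
  · exact pos L hL hf

lemma IsProgMarkovProcess.past_le (hΦ : IsProgMarkovProcess P Φ θ Pr) (t : ℝ≥0) :
    past Φ t ≤ mΩ := by
  rw [hΦ.sigma_eq]
  exact iSup_le fun s => le_iSup (fun s => MeasurableSpace.comap (Φ s) inferInstance) s.1

lemma measurable_past (Φ : ℝ≥0 → Ω → X) {s t : ℝ≥0} (h : s ≤ t) : Measurable[past Φ t] (Φ s) :=
  Measurable.of_comap_le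
    (le_iSup (fun s : Set.Iic t => MeasurableSpace.comap (Φ s) inferInstance) ⟨s, h⟩)

lemma IsProgMarkovProcess.measurable (hΦ : IsProgMarkovProcess P Φ θ Pr) (t : ℝ≥0) :
    Measurable (Φ t) :=
  (measurable_past Φ le_rfl).mono (hΦ.past_le t) le_rfl

/-- The Markov property as a formula for the joint law of the past and a later position. -/
lemma IsProgMarkovProcess.map_prodMk (hP : IsMarkovSemigroup P)
    (hΦ : IsProgMarkovProcess P Φ θ Pr) (x : X) (s t : ℝ≥0)
    {E : Type*} [MeasurableSpace E] {Y : Ω → E} (hY : Measurable[past Φ s] Y)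
    {q : E → X} (hq : Measurable q) (hqY : ∀ ω, q (Y ω) = Φ s ω) :
    (Pr x).map (fun ω => (Y ω, Φ (t + s) ω)) = (Pr x).map Y ⊗ₘ (P t).comap q hq := by
  have := hΦ.prob x
  have := hP.stochastic t
  have hYm : Measurable Y := hY.mono (hΦ.past_le s) le_rfl
  have := Measure.isProbabilityMeasure_map (μ := Pr x)
    (hYm.prodMk (hΦ.measurable (t + s))).aemeasurable
  refine Measure.ext_prod fun {B A} hB hA => ?_
  rw [Measure.map_apply (hYm.prodMk (hΦ.measurable _)) (hB.prod hA),
    Measure.compProd_apply_prod hB hA,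
    setLIntegral_map hB (Kernel.measurable_coe _ hA) hYm]
  simp only [Kernel.comap_apply, hqY]
  have hint : Integrable ((Φ (t + s) ⁻¹' A).indicator fun _ => (1 : ℝ)) (Pr x) :=
    (integrable_const 1).indicator (hΦ.measurable _ hA)
  have key : ∫ ω in Y ⁻¹' B, (P t (Φ s ω)).real A ∂(Pr x)
      = (Pr x).real (Y ⁻¹' B ∩ Φ (t + s) ⁻¹' A) := by
    have h1 := setIntegral_condExp (hΦ.past_le s) hint (hY hB)
    rw [setIntegral_congr_ae (g := fun ω => (P t (Φ s ω)).real A) (hYm hB)] at h1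
    · rw [h1, integral_indicator (hΦ.measurable _ hA), Measure.restrict_restrict
        (hΦ.measurable _ hA), Set.inter_comm]
      simp
    · filter_upwards [hΦ.markov x A hA s t] with ω hω _
      rw [hω, Measure.real, hΦ.transition _ A hA, Measure.real]
  have hset : (fun ω => (Y ω, Φ (t + s) ω)) ⁻¹' B ×ˢ A = Y ⁻¹' B ∩ Φ (t + s) ⁻¹' A := rfl
  have hmeas : Measurable fun ω => P t (Φ s ω) A :=
    (Kernel.measurable_coe _ hA).comp (hΦ.measurable s)
  rw [hset, ← ENNReal.ofReal_toReal (measure_ne_top (Pr x) (Y ⁻¹' B ∩ Φ (t + s) ⁻¹' A))]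
  change ENNReal.ofReal ((Pr x).real _) = _
  rw [← key]
  simp only [Measure.real]
  rw [integral_toReal hmeas.aemeasurable (ae_of_all _ fun ω => measure_lt_top _ _),
    ENNReal.ofReal_toReal]
  refine ((lintegral_mono fun ω => prob_le_one).trans_lt (?_ : ∫⁻ _ in Y ⁻¹' B, 1 ∂(Pr x) < ∞)).ne
  simp

lemma IsProgMarkovProcess.integral_prodMk (hP : IsMarkovSemigroup P)
    (hΦ : IsProgMarkovProcess P Φ θ Pr) (x : X) (s t : ℝ≥0)
    {E : Type*} [MeasurableSpace E] {Y : Ω → E} (hY : Measurable[past Φ s] Y)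
    {q : E → X} (hq : Measurable q) (hqY : ∀ ω, q (Y ω) = Φ s ω)
    {f : E × X → ℝ} (hf : Measurable f) {B : ℝ} (hB : ∀ e, |f e| ≤ B) :
    ∫ ω, f (Y ω, Φ (t + s) ω) ∂(Pr x) = ∫ ω, ∫ z, f (Y ω, z) ∂(P t (Φ s ω)) ∂(Pr x) := by
  have := hΦ.prob x
  have := hP.stochastic t
  have hYm : Measurable Y := hY.mono (hΦ.past_le s) le_rfl
  have := Measure.isProbabilityMeasure_map (μ := Pr x) hYm.aemeasurable
  have hYΦ := hYm.prodMk (hΦ.measurable (t + s))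
  rw [← integral_map (f := f) hYΦ.aemeasurable hf.aestronglyMeasurable,
    hΦ.map_prodMk hP x s t hY hq hqY, Measure.integral_compProd, integral_map hYm.aemeasurable]
  · simp [Kernel.comap_apply, hqY]
  · exact (hf.stronglyMeasurable.integral_kernel_prod_right'
      (κ := (P t).comap q hq)).aestronglyMeasurable
  · exact .of_bound hf.aestronglyMeasurable B (ae_of_all _ hB)

variable [SecondCountableTopology X] [BorelSpace X]

/-- Lipschitz functionals of finitely many positions have Lipschitz expectations, and the
contribution of a position at time `t` is damped by the factor `exp (-γ t)`. -/
lemma IsProgMarkovProcess.abs_integral_path_sub_le (hP : IsMarkovSemigroup P)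
    (hΦ : IsProgMarkovProcess P Φ θ Pr)
    (hγ : ∀ (t : ℝ≥0) (x y : X),
      wassersteinDist (P t x) (P t y) ≤ ENNReal.ofReal (Real.exp (-γ * t) * dist x y))
    {t : ℕ → ℝ≥0} (ht : Monotone t) (ht0 : t 0 = 0) (x y : X) {B : ℝ} (n : ℕ) :
    ∀ {H : (ℕ → X) → ℝ} {l : ℕ → ℝ}, (∀ j, 0 ≤ l j) → (∀ u, |H u| ≤ B) →
    (∀ u v, |H u - H v| ≤ ∑ j ∈ Finset.range (n + 1), l j * dist (u j) (v j)) →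
    |(∫ ω, H (fun j => Φ (t j) ω) ∂(Pr x)) - ∫ ω, H (fun j => Φ (t j) ω) ∂(Pr y)|
      ≤ (∑ j ∈ Finset.range (n + 1), l j * Real.exp (-γ * t j)) * dist x y := by
  induction n with
  | zero =>
    intro H l hl hB hH
    have h0 : ∀ x, ∫ ω, H (fun j => Φ (t j) ω) ∂(Pr x) = H fun _ => x := by
      intro x
      have := hΦ.prob x
      rw [integral_congr_ae (g := fun _ => H fun _ => x)]
      · simp
      · filter_upwards [hΦ.start x] with ω hω
        -- The Lipschitz bound with the single index `0` forces `H` to depend on `u 0` alone, and `Φ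
        -- 0 = x` almost surely.
        refine sub_eq_zero.1 (abs_nonpos_iff.1 ((hH _ _).trans ?_))
        simp [ht0, hω]
    rw [h0, h0]
    simpa [ht0] using hH (fun _ => x) fun _ => y
  | succ n ih =>
    intro H l hl hB hH
    set τ : ℝ≥0 := t (n + 1) - t n with hτ
    have hτt : τ + t n = t (n + 1) := tsub_add_cancel_of_le (ht n.le_succ)
    have := hP.stochastic τ
    have hHm := measurable_of_abs_sub_le (fun v => by fun_prop) (fun v => by simp) hH
    have hup : Measurable fun p : (ℕ → X) × X => Function.update p.1 (n + 1) p.2 := by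
      refine measurable_pi_iff.2 fun j => ?_
      by_cases hj : j = n + 1
      · subst hj; simpa using measurable_snd
      · simp only [Function.update_of_ne hj]
        fun_prop
    -- `H'` integrates out the last position. Its weight at index `n` grows by `a`, the contracted
    -- weight of the lost coordinate.
    set H' : (ℕ → X) → ℝ := fun u => ∫ z, H (Function.update u (n + 1) z) ∂(P τ (u n)) with hH'
    set a : ℝ := l (n + 1) * Real.exp (-γ * τ) with ha
    have ha0 : 0 ≤ a := mul_nonneg (hl _) (Real.exp_nonneg _)
    have hint : ∀ u w, Integrable (fun z => H (Function.update u (n + 1) z)) (P τ w) := fun u w =>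
      .of_bound (hHm.comp (hup.comp (measurable_const.prodMk measurable_id))).aestronglyMeasurable
        B (ae_of_all _ fun _ => hB _)
    have hB' : ∀ u, |H' u| ≤ B := fun u => abs_integral_le_of_abs_le _ fun _ => hB _
    have hLip' : ∀ u v, |H' u - H' v| ≤ ∑ j ∈ Finset.range (n + 1),
        (l j + if j = n then a else 0) * dist (u j) (v j) := by
      intro u v
      have hD : ∀ z, |H (Function.update u (n + 1) z) - H (Function.update v (n + 1) z)|
          ≤ ∑ j ∈ Finset.range (n + 1), l j * dist (u j) (v j) := by
        intro z
        refine (hH _ _).trans_eq ?_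
        rw [Finset.sum_range_succ]
        simp only [Function.update_self, dist_self, mul_zero, add_zero]
        refine Finset.sum_congr rfl fun j hj => ?_
        have : j ≠ n + 1 := by have := Finset.mem_range.1 hj; omega
        rw [Function.update_of_ne this, Function.update_of_ne this]
      have h1 : |H' u - ∫ z, H (Function.update v (n + 1) z) ∂(P τ (u n))|
          ≤ ∑ j ∈ Finset.range (n + 1), l j * dist (u j) (v j) := by
        rw [hH', ← integral_sub (hint _ _) (hint _ _)]
        exact abs_integral_le_of_abs_le _ hD
      have h2 : |(∫ z, H (Function.update v (n + 1) z) ∂(P τ (u n))) - H' v|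
          ≤ a * dist (u n) (v n) := by
        rw [ha, mul_assoc]
        refine abs_integral_sub_le_of_wassersteinDist_le hγ (hl _) (fun z w => ?_) τ (u n) (v n)
        refine (hH _ _).trans_eq ?_
        rw [Finset.sum_range_succ, Finset.sum_eq_zero, zero_add]
        · simp
        · intro j hj
          have : j ≠ n + 1 := by have := Finset.mem_range.1 hj; omega
          simp [Function.update_of_ne this]
      refine (abs_sub_le _ _ _).trans ((add_le_add h1 h2).trans_eq ?_)
      simp [add_mul, Finset.sum_add_distrib, ite_mul]
    have hstep : ∀ x, ∫ ω, H (fun j => Φ (t j) ω) ∂(Pr x)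
        = ∫ ω, H' (fun j => Φ (t j) ω) ∂(Pr x) := by
      intro x
      -- Freezing the path after index `n` makes the whole sequence measurable with respect to the
      -- past. Neither `H` after the update nor `H'` notices the change, as they depend only on
      -- indices up to `n + 1` and `n` respectively.
      have hY : Measurable[past Φ (t n)] fun ω (j : ℕ) => Φ (t (min j n)) ω :=
        @measurable_pi_lambda _ _ _ (past Φ (t n)) _ _ fun j =>
          measurable_past Φ (ht (min_le_right _ _))
      have h := hΦ.integral_prodMk hP x (t n) τ hY (measurable_pi_apply n) (by simp)
        (f := fun p => H (Function.update p.1 (n + 1) p.2)) (hHm.comp hup) (fun _ => hB _)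
      rw [hτt] at h
      have e1 : ∀ ω, H (Function.update (fun j => Φ (t (min j n)) ω) (n + 1) (Φ (t (n + 1)) ω))
          = H (fun j => Φ (t j) ω) := by
        intro ω
        refine sub_eq_zero.1 (abs_nonpos_iff.1 ((hH _ _).trans_eq (Finset.sum_eq_zero ?_)))
        intro j hj
        rcases (Nat.lt_succ_iff.1 (Finset.mem_range.1 hj)).eq_or_lt with rfl | hj
        · simp
        · rw [Function.update_of_ne hj.ne, min_eq_left (by omega), dist_self, mul_zero]
      have e2 : ∀ ω, H' (fun j => Φ (t (min j n)) ω) = H' (fun j => Φ (t j) ω) := by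
        intro ω
        refine sub_eq_zero.1 (abs_nonpos_iff.1 ((hLip' (fun j => Φ (t (min j n)) ω)
          fun j => Φ (t j) ω).trans_eq (Finset.sum_eq_zero fun j hj => ?_)))
        rw [min_eq_left (Nat.lt_succ_iff.1 (Finset.mem_range.1 hj)), dist_self, mul_zero]
      simp only [e1] at h
      rw [h]
      refine integral_congr_ae (ae_of_all _ fun ω => Eq.trans ?_ (e2 ω))
      simp [hH']
    rw [hstep, hstep]
    refine (ih (fun j => ?_) hB' hLip').trans_eq ?_
    · exact add_nonneg (hl j) (by split_ifs <;> simp [ha0])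
    · congr 1
      rw [Finset.sum_range_succ (n := n + 1)]
      simp only [add_mul, Finset.sum_add_distrib, ite_mul, zero_mul, Finset.sum_ite_eq',
        Finset.mem_range, Nat.lt_succ_self, if_true]
      rw [ha, mul_assoc, ← Real.exp_add, ← hτt, NNReal.coe_add]
      ring_nf

end PathLipschitz

/-! ### Lipschitz continuity of the corrector -/

section Corrector

variable {X : Type*} [MetricSpace X] [SecondCountableTopology X] [MeasurableSpace X]
  [BorelSpace X] {P : ℝ≥0 → Kernel X X} {γ : ℝ}

lemma integral_bind_kernel {ν : Measure X} [IsProbabilityMeasure ν] (κ : Kernel X X)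
    [IsMarkovKernel κ] {f : X → ℝ} (hf : Measurable f) {B : ℝ} (hB : ∀ u, |f u| ≤ B) :
    ∫ u, f u ∂(ν.bind κ) = ∫ y, ∫ u, f u ∂(κ y) ∂ν := by
  have : IsProbabilityMeasure (ν.bind κ) := inferInstanceAs (IsProbabilityMeasure (κ ∘ₘ ν))
  have hint : Integrable f (κ ∘ₘ ν) := .of_bound hf.aestronglyMeasurable B (ae_of_all _ hB)
  rw [Measure.comp_eq_comp_const_apply] at hint
  simpa [← Measure.comp_eq_comp_const_apply] using Kernel.integral_comp hint

/-- The exponential mixing makes `P_t f` asymptotically constant. -/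
lemma tendsto_integral_semigroup_sub (hP : IsMarkovSemigroup P) (hγ0 : 0 < γ)
    (hγ : ∀ (t : ℝ≥0) (x y : X),
      wassersteinDist (P t x) (P t y) ≤ ENNReal.ofReal (Real.exp (-γ * t) * dist x y))
    {f : X → ℝ} {L B : ℝ} (hL : 0 ≤ L) (hf : ∀ u v, |f u - f v| ≤ L * dist u v)
    (hfm : Measurable f) (hB : ∀ u, |f u| ≤ B) (ν : Measure X) [IsProbabilityMeasure ν] (x₀ : X) :
    Tendsto (fun n : ℕ => (∫ u, f u ∂(ν.bind (P n))) - ∫ u, f u ∂(P n x₀)) atTop (𝓝 0) := by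
  have hst := hP.stochastic
  have hmeas : ∀ n : ℕ, Measurable fun y => ∫ u, f u ∂(P n y) := fun n =>
    (StronglyMeasurable.integral_kernel (κ := P n) hfm.stronglyMeasurable).measurable
  have hb : ∀ (n : ℕ) y, |∫ u, f u ∂(P n y)| ≤ B := fun n y => abs_integral_le_of_abs_le _ hB
  have heq : ∀ n : ℕ, (∫ u, f u ∂(ν.bind (P n))) - ∫ u, f u ∂(P n x₀)
      = ∫ y, ((∫ u, f u ∂(P n y)) - ∫ u, f u ∂(P n x₀)) ∂ν := by
    intro n
    rw [integral_bind_kernel _ hfm hB, integral_sub _ (integrable_const _)]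
    · simp
    · exact .of_bound (hmeas n).aestronglyMeasurable B (ae_of_all _ (hb n))
  simp only [heq]
  have hlim : ∀ y, Tendsto (fun n : ℕ => (∫ u, f u ∂(P n y)) - ∫ u, f u ∂(P n x₀)) atTop (𝓝 0) := by
    intro y
    have h1 : Tendsto (fun n : ℕ => L * (Real.exp (-γ * n) * dist y x₀)) atTop (𝓝 0) := by
      have : Tendsto (fun n : ℕ => -γ * (n : ℝ)) atTop atBot :=
        tendsto_natCast_atTop_atTop.const_mul_atTop_of_neg (neg_lt_zero.2 hγ0)
      simpa using ((Real.tendsto_exp_atBot.comp this).mul_const (dist y x₀)).const_mul L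
    refine squeeze_zero_norm (fun n => ?_) h1
    simpa using abs_integral_sub_le_of_wassersteinDist_le hγ hL hf n y x₀
  have := tendsto_integral_of_dominated_convergence (μ := ν) (f := fun _ => (0 : ℝ))
    (fun _ => B + B) (fun n => ((hmeas n).sub_const _).aestronglyMeasurable) (integrable_const _)
    (fun n => ae_of_all _ fun y => (norm_sub_le _ _).trans (add_le_add (hb n y) (hb n x₀)))
    (ae_of_all _ hlim)
  simpa using this

/-- The truncation `min (dist x₀ ·) M` has asymptotically the same mean under `μ P_n` as under
`μstar P_n = μstar`. The moment bound for `μ P_n` and `r ≤ 1 + r ^ ζ` control that mean uniformly in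
`M`, and monotone convergence removes the truncation. -/
lemma integrable_dist_of_isInvariant (hP : IsMarkovSemigroup P) (hγ0 : 0 < γ)
    (hγ : ∀ (t : ℝ≥0) (x y : X),
      wassersteinDist (P t x) (P t y) ≤ ENNReal.ofReal (Real.exp (-γ * t) * dist x y))
    {μ : Measure X} [IsProbabilityMeasure μ] (hA4 : UniformlyBoundedMoment P μ)
    {μstar : Measure X} [IsProbabilityMeasure μstar] (hμstar : IsInvariant P μstar) (x : X) :
    Integrable (fun y => dist x y) μstar := by
  obtain ⟨x₀, ζ, hζ, hS⟩ := hA4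
  have hst := hP.stochastic
  set S := ⨆ t : ℝ≥0, ∫⁻ x, ENNReal.ofReal (dist x₀ x ^ ζ) ∂(μ.bind (P t))
  have hfm : ∀ M : ℕ, Measurable fun y => min (dist x₀ y) (M : ℝ) := fun M => by fun_prop
  have hfB : ∀ (M : ℕ) y, |min (dist x₀ y) (M : ℝ)| ≤ M := fun M y => by
    rw [abs_of_nonneg (by positivity)]; exact min_le_right _ _
  have hfL : ∀ (M : ℕ) u v, |min (dist x₀ u) (M : ℝ) - min (dist x₀ v) (M : ℝ)|
      ≤ 1 * dist u v := fun M u v => by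
    refine (abs_min_sub_min_le_max _ _ _ _).trans ?_
    rw [sub_self, abs_zero, one_mul, max_eq_left (abs_nonneg _), dist_comm x₀ u, dist_comm x₀ v]
    exact abs_dist_sub_le _ _ _
  have hbound : ∀ M : ℕ, ∫ y, min (dist x₀ y) (M : ℝ) ∂μstar ≤ 1 + S.toReal := by
    intro M
    have h1 := (tendsto_integral_semigroup_sub hP hγ0 hγ zero_le_one (hfL M) (hfm M) (hfB M)
      μstar x₀).sub (tendsto_integral_semigroup_sub hP hγ0 hγ zero_le_one (hfL M) (hfm M) (hfB M)
      μ x₀)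
    simp only [sub_sub_sub_cancel_right, sub_zero, hμstar _] at h1
    have h2 : ∀ n : ℕ, (∫ y, min (dist x₀ y) (M : ℝ) ∂μstar) - (1 + S.toReal)
        ≤ (∫ y, min (dist x₀ y) (M : ℝ) ∂μstar)
          - ∫ y, min (dist x₀ y) (M : ℝ) ∂(μ.bind (P n)) := by
      intro n
      have : IsProbabilityMeasure (μ.bind (P n)) :=
        inferInstanceAs (IsProbabilityMeasure (P n ∘ₘ μ))
      refine sub_le_sub_left ?_ _
      rw [integral_eq_lintegral_of_nonneg_ae (ae_of_all _ fun y => by positivity)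
        (hfm M).aestronglyMeasurable]
      have hle : ∫⁻ y, ENNReal.ofReal (min (dist x₀ y) (M : ℝ)) ∂(μ.bind (P n)) ≤ 1 + S := by
        calc _ ≤ ∫⁻ y, (1 + ENNReal.ofReal (dist x₀ y ^ ζ)) ∂(μ.bind (P n)) := by
              refine lintegral_mono fun y => ?_
              rw [← ENNReal.ofReal_one, ← ENNReal.ofReal_add zero_le_one (by positivity)]
              refine ENNReal.ofReal_le_ofReal ((min_le_left _ _).trans ?_)
              rcases le_total (dist x₀ y) 1 with h | h
              · exact h.trans (le_add_of_nonneg_right (by positivity))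
              · exact (Real.self_le_rpow_of_one_le h (by linarith)).trans
                  (le_add_of_nonneg_left zero_le_one)
          _ = 1 + ∫⁻ y, ENNReal.ofReal (dist x₀ y ^ ζ) ∂(μ.bind (P n)) := by
              rw [lintegral_add_left measurable_const]; simp
          _ ≤ 1 + S := by
              gcongr
              exact le_iSup (fun t : ℝ≥0 =>
                ∫⁻ x, ENNReal.ofReal (dist x₀ x ^ ζ) ∂(μ.bind (P t))) (n : ℝ≥0)
      refine (ENNReal.toReal_mono (by finiteness) hle).trans_eq ?_
      rw [ENNReal.toReal_add ENNReal.one_ne_top hS.ne, ENNReal.toReal_one]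
    linarith [ge_of_tendsto' h1 h2]
  have hlin : ∫⁻ y, ENNReal.ofReal (dist x₀ y) ∂μstar ≤ ENNReal.ofReal (1 + S.toReal) := by
    have ht : Tendsto (fun M : ℕ => ∫⁻ y, ENNReal.ofReal (min (dist x₀ y) (M : ℝ)) ∂μstar) atTop
        (𝓝 (∫⁻ y, ENNReal.ofReal (dist x₀ y) ∂μstar)) := by
      refine lintegral_tendsto_of_tendsto_of_monotone
        (fun M => (hfm M).ennreal_ofReal.aemeasurable)
        (ae_of_all _ fun y M N h => ENNReal.ofReal_le_ofReal (by gcongr)) (ae_of_all _ fun y => ?_)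
      refine tendsto_const_nhds.congr' ?_
      obtain ⟨M, hM⟩ := exists_nat_ge (dist x₀ y)
      filter_upwards [eventually_ge_atTop M] with N hN
      rw [min_eq_left (hM.trans (by exact_mod_cast hN))]
    refine le_of_tendsto' ht fun M => ?_
    rw [← ofReal_integral_eq_lintegral_ofReal
      (.of_bound (hfm M).aestronglyMeasurable M (ae_of_all _ (hfB M)))
      (ae_of_all _ fun y => by positivity)]
    exact ENNReal.ofReal_le_ofReal (hbound M)
  have hint : Integrable (fun y => dist x₀ y) μstar := by
    refine ⟨by fun_prop, ?_⟩
    rw [hasFiniteIntegral_iff_ofReal (ae_of_all _ fun y => dist_nonneg)]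
    exact hlin.trans_lt ENNReal.ofReal_lt_top
  refine ((integrable_const (dist x x₀)).add hint).mono' (by fun_prop) (ae_of_all _ fun y => ?_)
  rw [Real.norm_of_nonneg dist_nonneg]
  exact dist_triangle _ _ _

/-- By invariance and centring, `P_t g(x)` is the `μstar`-mean of `P_t g(x) - P_t g(y)` over `y`,
and each difference decays exponentially. This gives absolute convergence of the corrector integral.
-/
lemma abs_integral_semigroup_le (hP : IsMarkovSemigroup P)
    (hγ : ∀ (t : ℝ≥0) (x y : X),
      wassersteinDist (P t x) (P t y) ≤ ENNReal.ofReal (Real.exp (-γ * t) * dist x y))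
    {μstar : Measure X} [IsProbabilityMeasure μstar] (hμstar : IsInvariant P μstar)
    (hint : ∀ x, Integrable (fun y => dist x y) μstar)
    {g : X → ℝ} {K B : ℝ} (hK : 0 ≤ K) (hg : ∀ u v, |g u - g v| ≤ K * dist u v)
    (hgm : Measurable g) (hB : ∀ u, |g u| ≤ B) (hg_mean : ∫ x, g x ∂μstar = 0)
    (t : ℝ≥0) (x : X) :
    |∫ u, g u ∂(P t x)| ≤ Real.exp (-γ * t) * (K * ∫ y, dist x y ∂μstar) := by
  have := hP.stochastic t
  have hmeas : Measurable fun y => ∫ u, g u ∂(P t y) :=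
    (StronglyMeasurable.integral_kernel (κ := P t) hgm.stronglyMeasurable).measurable
  have heq : ∫ u, g u ∂(P t x) = ∫ y, ((∫ u, g u ∂(P t x)) - ∫ u, g u ∂(P t y)) ∂μstar := by
    rw [integral_sub (integrable_const _), ← integral_bind_kernel _ hgm hB, hμstar t, hg_mean]
    · simp
    · exact .of_bound hmeas.aestronglyMeasurable B
        (ae_of_all _ fun y => abs_integral_le_of_abs_le _ hB)
  rw [heq, ← integral_const_mul, ← integral_const_mul]
  rw [← Real.norm_eq_abs]
  refine norm_integral_le_of_norm_le (((hint x).const_mul K).const_mul _)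
    (ae_of_all _ fun y => ?_)
  refine (abs_integral_sub_le_of_wassersteinDist_le hγ hK hg t x y).trans_eq ?_
  ring

lemma measurable_integral_semigroup (hP : IsMarkovSemigroup P) {g : X → ℝ} (hgm : Measurable g)
    (x : X) : Measurable fun t : ℝ≥0 => ∫ u, g u ∂(P t x) := by
  have := hP.stochastic
  let κ : Kernel ℝ≥0 X := ⟨fun t => P t x, Measure.measurable_of_measurable_coe _ fun A hA =>
    (hP.jointly_measurable A hA).comp (measurable_id.prodMk measurable_const)⟩
  exact (StronglyMeasurable.integral_kernel (κ := κ) hgm.stronglyMeasurable).measurable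

/-- The corrector is Lipschitz; the integral defining it converges absolutely. -/
lemma abs_corrector_sub_le (hP : IsMarkovSemigroup P) (hγ0 : 0 < γ)
    (hγ : ∀ (t : ℝ≥0) (x y : X),
      wassersteinDist (P t x) (P t y) ≤ ENNReal.ofReal (Real.exp (-γ * t) * dist x y))
    {μstar : Measure X} [IsProbabilityMeasure μstar] (hμstar : IsInvariant P μstar)
    (hint : ∀ x, Integrable (fun y => dist x y) μstar)
    {g : X → ℝ} {K B : ℝ} (hK : 0 ≤ K) (hg : ∀ u v, |g u - g v| ≤ K * dist u v)
    (hgm : Measurable g) (hB : ∀ u, |g u| ≤ B) (hg_mean : ∫ x, g x ∂μstar = 0) (x y : X) :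
    |corrector P g x - corrector P g y| ≤ K / γ * dist x y := by
  have hexp : ∀ c : ℝ, IntegrableOn (fun t : ℝ => Real.exp (-γ * t) * c) (Set.Ioi 0) := fun c =>
    (exp_neg_integrableOn_Ioi 0 hγ0).mul_const c
  have hI : ∀ x, IntegrableOn (fun t : ℝ => ∫ u, g u ∂(P t.toNNReal x)) (Set.Ioi 0) := by
    intro x
    refine (hexp (K * ∫ y, dist x y ∂μstar)).mono'
      ((measurable_integral_semigroup hP hgm x).comp measurable_real_toNNReal).aestronglyMeasurable
      ?_
    filter_upwards [ae_restrict_mem measurableSet_Ioi] with t ht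
    have := abs_integral_semigroup_le hP hγ hμstar hint hK hg hgm hB hg_mean t.toNNReal x
    rwa [Real.coe_toNNReal t (le_of_lt ht)] at this
  rw [corrector, corrector, ← integral_sub (hI x) (hI y), ← Real.norm_eq_abs]
  refine (norm_integral_le_of_norm_le (hexp (K * dist x y)) ?_).trans_eq ?_
  · filter_upwards [ae_restrict_mem measurableSet_Ioi] with t ht
    have := abs_integral_sub_le_of_wassersteinDist_le hγ hK hg t.toNNReal x y
    rw [Real.coe_toNNReal t (le_of_lt ht)] at this
    refine this.trans_eq ?_
    ring
  · rw [integral_mul_const, integral_exp_mul_Ioi (neg_lt_zero.2 hγ0)]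
    simp
    field_simp

end Corrector

/-! ### Riemann sums for the time integral along the process -/

section RiemannSums

variable {X : Type*} [MetricSpace X] [SecondCountableTopology X] [MeasurableSpace X]
  [BorelSpace X] {Ω : Type*} [mΩ : MeasurableSpace Ω]
  {P : ℝ≥0 → Kernel X X} {Φ : ℝ≥0 → Ω → X} {θ : ℝ≥0 → Ω → Ω} {Pr : X → Measure Ω}

lemma IsProgMarkovProcess.measurable_uncurry (hΦ : IsProgMarkovProcess P Φ θ Pr) :
    Measurable fun q : ℝ≥0 × Ω => Φ q.1 q.2 := by
  have hM : ∀ M : ℕ, Measurable fun q : ℝ≥0 × Ω => Φ (min q.1 M) q.2 := by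
    intro M
    have h1 : Measurable (fun q : Set.Iic (M : ℝ≥0) × Ω => Φ q.1 q.2) :=
      (hΦ.progressive M).mono (sup_le_sup le_rfl (MeasurableSpace.comap_mono (hΦ.past_le M)))
        le_rfl
    have h2 : Measurable fun q : ℝ≥0 × Ω =>
        ((⟨min q.1 M, Set.mem_Iic.2 (min_le_right _ _)⟩ : Set.Iic (M : ℝ≥0)), q.2) :=
      ((measurable_fst.min measurable_const).subtype_mk).prodMk measurable_snd
    exact h1.comp h2
  refine measurable_of_tendsto_metrizable hM (tendsto_pi_nhds.2 fun q => ?_)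
  refine tendsto_const_nhds.congr' ?_
  obtain ⟨M, hM⟩ := exists_nat_ge q.1
  filter_upwards [eventually_ge_atTop M] with N hN
  rw [min_eq_left (hM.trans (by exact_mod_cast hN))]

/-- Right continuity of `Φ` in mean, seen through a bounded continuous function. -/
lemma IsProgMarkovProcess.tendsto_integral_abs_sub (hP : IsMarkovSemigroup P)
    (hΦ : IsProgMarkovProcess P Φ θ Pr) (hA1 : StochasticallyContinuous P)
    {g : X → ℝ} (hg : Continuous g) {B : ℝ} (hB : ∀ u, |g u| ≤ B) (x : X) (s : ℝ≥0) :
    Tendsto (fun h : ℝ≥0 => ∫ ω, |g (Φ (h + s) ω) - g (Φ s ω)| ∂(Pr x)) (𝓝 0) (𝓝 0) := by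
  have := hΦ.prob x
  have hst := hP.stochastic
  have hbd : ∀ u v, |(|g u - g v|)| ≤ B + B := fun u v => by
    rw [abs_abs]; exact (abs_sub _ _).trans (add_le_add (hB u) (hB v))
  have hfm : Measurable fun p : X × X => |g p.2 - g p.1| := by
    have := hg.measurable
    fun_prop
  have heq : ∀ h : ℝ≥0, ∫ ω, |g (Φ (h + s) ω) - g (Φ s ω)| ∂(Pr x)
      = ∫ ω, ∫ z, |g z - g (Φ s ω)| ∂(P h (Φ s ω)) ∂(Pr x) := fun h =>
    hΦ.integral_prodMk hP x s h (measurable_past Φ le_rfl) measurable_id (fun _ => rfl)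
      hfm (fun e => hbd _ _)
  have hright : Tendsto (fun h : ℝ≥0 => ∫ ω, |g (Φ (h + s) ω) - g (Φ s ω)| ∂(Pr x))
      (𝓝[>] 0) (𝓝 0) := by
    simp only [heq]
    have hpt : ∀ y, Tendsto (fun h : ℝ≥0 => ∫ z, |g z - g y| ∂(P h y)) (𝓝[>] 0) (𝓝 0) := by
      intro y
      let f : X →ᵇ ℝ := BoundedContinuousFunction.ofNormedAddCommGroup (fun z => |g z - g y|)
        (by fun_prop) (B + B) fun z => hbd _ _
      simpa [f] using hA1 f y
    have hmeas : ∀ h : ℝ≥0, Measurable fun y => ∫ z, |g z - g y| ∂(P h y) := fun h =>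
      (hfm.stronglyMeasurable.integral_kernel_prod_right' (κ := P h)).measurable
    have := tendsto_integral_filter_of_dominated_convergence (μ := Pr x) (l := 𝓝[>] (0 : ℝ≥0))
      (F := fun h ω => ∫ z, |g z - g (Φ s ω)| ∂(P h (Φ s ω))) (f := fun _ => (0 : ℝ))
      (fun _ => B + B)
      (Eventually.of_forall fun h => ((hmeas h).comp (hΦ.measurable s)).aestronglyMeasurable)
      (Eventually.of_forall fun h => ae_of_all _ fun ω => abs_integral_le_of_abs_le _ fun z =>
        hbd _ _) (integrable_const _) (ae_of_all _ fun ω => hpt _)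
    simpa using this
  -- At `h = 0` the function vanishes, so the one-sided limit is a full limit in `ℝ≥0`.
  have hcont : ContinuousWithinAt
      (fun h : ℝ≥0 => ∫ ω, |g (Φ (h + s) ω) - g (Φ s ω)| ∂(Pr x)) (Set.Ioi 0) 0 := by
    simpa [ContinuousWithinAt] using hright
  rw [continuousWithinAt_Ioi_iff_Ici, show Set.Ici (0 : ℝ≥0) = Set.univ by ext; simp,
    continuousWithinAt_univ] at hcont
  simpa [ContinuousAt] using hcont

/-- The smallest multiple of `1 / N` that is at least `s`. -/
noncomputable def gridCeil (N : ℕ) (s : ℝ) : ℝ≥0 := (⌈s * N⌉₊ : ℝ≥0) / N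

lemma measurable_gridCeil (N : ℕ) : Measurable (gridCeil N) := by
  unfold gridCeil
  have : Measurable fun s : ℝ => ⌈s * N⌉₊ := Nat.measurable_ceil.comp (measurable_id.mul_const _)
  exact ((measurable_from_nat (f := fun n : ℕ => (n : ℝ≥0))).comp this).div_const _

lemma le_gridCeil {N : ℕ} (hN : 0 < N) (s : ℝ) : s.toNNReal ≤ gridCeil N s := by
  have hN' : (0 : ℝ) < N := by exact_mod_cast hN
  rw [gridCeil, Real.toNNReal_le_iff_le_coe]
  push_cast
  rw [le_div_iff₀ hN']
  exact Nat.le_ceil _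

lemma tendsto_gridCeil_sub {s : ℝ} (hs : 0 ≤ s) :
    Tendsto (fun N : ℕ => gridCeil N s - s.toNNReal) atTop (𝓝 0) := by
  have h : Tendsto (fun N : ℕ => ((gridCeil N s : ℝ≥0) : ℝ)) atTop (𝓝 s) := by
    simpa [gridCeil, Function.comp_def] using (tendsto_nat_ceil_mul_div_atTop (R := ℝ) hs).comp
      (tendsto_natCast_atTop_atTop (R := ℝ))
  have h' : Tendsto (fun N : ℕ => gridCeil N s) atTop (𝓝 s.toNNReal) := by
    rw [← NNReal.tendsto_coe, Real.coe_toNNReal s hs]; exact h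
  simpa using h'.sub (tendsto_const_nhds (x := s.toNNReal))

lemma integral_comp_gridCeil {N : ℕ} (hN : 0 < N) (f : ℝ≥0 → ℝ) (m : ℕ)
    (hf : IntegrableOn (fun s => f (gridCeil N s)) (Set.Ioc (m : ℝ) (m + 1))) :
    ∫ s in (m : ℝ)..(m + 1), f (gridCeil N s)
      = (∑ j ∈ Finset.range N, f (((m * N + j + 1 : ℕ) : ℝ≥0) / N)) / N := by
  have hN' : (0 : ℝ) < N := by exact_mod_cast hN
  set a : ℕ → ℝ := fun j => ((m * N + j : ℕ) : ℝ) / N with ha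
  have ha0 : a 0 = m := by simp [ha, hN'.ne']
  have haN : a N = m + 1 := by
    simp only [ha]; push_cast; field_simp
  have hmono : Monotone a := fun i j hij => by
    simp only [ha]; gcongr
  have hint : ∀ k < N, IntervalIntegrable (fun s => f (gridCeil N s)) volume (a k) (a (k + 1)) := by
    intro k hk
    rw [intervalIntegrable_iff_integrableOn_Ioc_of_le (hmono k.le_succ)]
    refine hf.mono_set (Set.Ioc_subset_Ioc ?_ ?_)
    · rw [← ha0]; exact hmono (Nat.zero_le _)
    · rw [← haN]; exact hmono hk
  have hsum := intervalIntegral.sum_integral_adjacent_intervals hint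
  rw [ha0, haN] at hsum
  rw [← hsum, Finset.sum_div]
  refine Finset.sum_congr rfl fun j _ => ?_
  rw [intervalIntegral.integral_of_le (hmono j.le_succ)]
  rw [setIntegral_congr_fun (g := fun _ => f (((m * N + j + 1 : ℕ) : ℝ≥0) / N)) measurableSet_Ioc]
  · rw [setIntegral_const]
    have : a (j + 1) - a j = 1 / N := by
      simp only [ha]; push_cast; field_simp; ring
    rw [Real.volume_real_Ioc_of_le (hmono j.le_succ), this, smul_eq_mul]
    ring
  · intro s hs
    have hceil : ⌈s * N⌉₊ = m * N + j + 1 := by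
      rw [Nat.ceil_eq_iff (by omega)]
      refine ⟨?_, ?_⟩
      · have := hs.1
        simp only [ha] at this
        rw [div_lt_iff₀ hN'] at this
        simpa using this
      · have := hs.2
        simp only [ha] at this
        rw [le_div_iff₀ hN'] at this
        exact_mod_cast this
    simp only [gridCeil, hceil]

lemma IsProgMarkovProcess.measurable_comp (hΦ : IsProgMarkovProcess P Φ θ Pr)
    {g : X → ℝ} (hg : Measurable g) {τ : ℝ → ℝ≥0} (hτ : Measurable τ) :
    Measurable fun q : ℝ × Ω => g (Φ (τ q.1) q.2) :=
  hg.comp (hΦ.measurable_uncurry.comp ((hτ.comp measurable_fst).prodMk measurable_snd))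

/-- No regularity of single paths is available, so convergence is in mean. By Fubini the error is at
most the integral over `s` of `𝔼|g(Φ(gridCeil N s)) - g(Φ s)|`. Rounding times upwards lets right
continuity in mean apply for each `s`. -/
lemma IsProgMarkovProcess.tendsto_riemannSum (hP : IsMarkovSemigroup P)
    (hΦ : IsProgMarkovProcess P Φ θ Pr) (hA1 : StochasticallyContinuous P)
    {g : X → ℝ} (hg : Continuous g) {B : ℝ} (hB : ∀ u, |g u| ≤ B) (x : X) (m : ℕ) :
    Tendsto (fun N : ℕ => ∫ ω, |(∑ j ∈ Finset.range N, g (Φ (((m * N + j + 1 : ℕ) : ℝ≥0) / N) ω)) / N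
      - ∫ s in (m : ℝ)..(m + 1), g (Φ s.toNNReal ω)| ∂(Pr x)) atTop (𝓝 0) := by
  have := hΦ.prob x
  set ν : Measure ℝ := volume.restrict (Set.Ioc (m : ℝ) (m + 1)) with hν
  have hm1 : (m : ℝ) ≤ m + 1 := by linarith
  have hmeas : ∀ τ : ℝ → ℝ≥0, Measurable τ → Measurable fun q : ℝ × Ω => g (Φ (τ q.1) q.2) :=
    fun τ hτ => hΦ.measurable_comp hg.measurable hτ
  have hintτ : ∀ τ : ℝ → ℝ≥0, Measurable τ → ∀ ω, Integrable (fun s => g (Φ (τ s) ω)) ν :=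
    fun τ hτ ω => .of_bound
      ((hmeas τ hτ).comp (measurable_id.prodMk measurable_const)).aestronglyMeasurable B
      (ae_of_all _ fun _ => hB _)
  set D : ℕ → ℝ → Ω → ℝ := fun N s ω => |g (Φ (gridCeil N s) ω) - g (Φ s.toNNReal ω)| with hD
  have hDm : ∀ N, Measurable fun q : ℝ × Ω => D N q.1 q.2 := fun N =>
    ((hmeas _ (measurable_gridCeil N)).sub (hmeas _ measurable_real_toNNReal)).abs
  have hDb : ∀ N s ω, |D N s ω| ≤ B + B := fun N s ω => by
    rw [hD, abs_abs]; exact (abs_sub _ _).trans (add_le_add (hB _) (hB _))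
  have hlim : Tendsto (fun N : ℕ => ∫ s, ∫ ω, D N s ω ∂(Pr x) ∂ν) atTop (𝓝 0) := by
    have := tendsto_integral_of_dominated_convergence (μ := ν)
      (F := fun N s => ∫ ω, D N s ω ∂(Pr x)) (f := fun _ => (0 : ℝ)) (fun _ => B + B)
      (fun N => (hDm N).stronglyMeasurable.integral_prod_right'.aestronglyMeasurable)
      (integrable_const _) (fun N => ae_of_all _ fun s => abs_integral_le_of_abs_le _ (hDb N s)) ?_
    · simpa using this
    · filter_upwards [ae_restrict_mem measurableSet_Ioc] with s hs
      have hs0 : 0 ≤ s := (Nat.cast_nonneg m).trans hs.1.le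
      refine ((hΦ.tendsto_integral_abs_sub hP hA1 hg hB x s.toNNReal).comp
        (tendsto_gridCeil_sub hs0)).congr' ?_
      filter_upwards [eventually_gt_atTop 0] with N hN
      simp only [Function.comp_apply, hD, tsub_add_cancel_of_le (le_gridCeil hN s)]
  refine squeeze_zero' (Eventually.of_forall fun N => integral_nonneg fun ω => abs_nonneg _) ?_ hlim
  filter_upwards [eventually_gt_atTop 0] with N hN
  have hI : Integrable (fun q : ℝ × Ω => D N q.1 q.2) (ν.prod (Pr x)) :=
    .of_bound (hDm N).aestronglyMeasurable (B + B) (ae_of_all _ fun q => hDb _ _ _)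
  rw [integral_integral_swap hI]
  refine integral_mono_of_nonneg (ae_of_all _ fun ω => abs_nonneg _) hI.integral_prod_right
    (ae_of_all _ fun ω => ?_)
  beta_reduce
  rw [← integral_comp_gridCeil hN (fun t => g (Φ t ω)) m (hintτ _ (measurable_gridCeil N) ω),
    intervalIntegral.integral_of_le hm1, intervalIntegral.integral_of_le hm1,
    ← integral_sub (hintτ _ (measurable_gridCeil N) ω) (hintτ _ measurable_real_toNNReal ω)]
  exact abs_integral_le_integral_abs

end RiemannSums

/-! ### Dependence of functionals of the increments on the starting point -/

section Increments

/-- The combination of the values of `w` on the grid of mesh `1 / N` which controls the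
increment over `[m, m + 1]`. -/
noncomputable def gridWeight (c K : ℝ) (N m : ℕ) (w : ℕ → ℝ) : ℝ :=
  c * (w ((m + 1) * N) + w (m * N)) + K * ((∑ j ∈ Finset.range N, w (m * N + j + 1)) / N)

lemma gridWeight_mono {c K : ℝ} (hc : 0 ≤ c) (hK : 0 ≤ K) (N m : ℕ) {w w' : ℕ → ℝ}
    (h : ∀ k, m * N ≤ k → w k ≤ w' k) : gridWeight c K N m w ≤ gridWeight c K N m w' := by
  unfold gridWeight
  have h1 := h ((m + 1) * N) (Nat.mul_le_mul_right _ m.le_succ)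
  have h2 := h (m * N) le_rfl
  have h3 : ∑ j ∈ Finset.range N, w (m * N + j + 1) ≤ ∑ j ∈ Finset.range N, w' (m * N + j + 1) :=
    Finset.sum_le_sum fun j _ => h _ (by omega)
  gcongr

lemma gridWeight_const {c K : ℝ} {N : ℕ} (hN : 0 < N) (m : ℕ) (a : ℝ) :
    gridWeight c K N m (fun _ => a) = (2 * c + K) * a := by
  have : (N : ℝ) ≠ 0 := by positivity
  simp only [gridWeight, Finset.sum_const, Finset.card_range, nsmul_eq_mul]
  field_simp
  ring

/-- `gridWeight` is linear in `w`, and its value at `Pi.single k 1` is the coefficient of `w k`.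
This puts the increment bounds into the form `∑ l k * w k` needed by `abs_integral_path_sub_le`. -/
lemma sum_gridWeight_single (c K : ℝ) {N m M : ℕ} (hm : m < M) (w : ℕ → ℝ) :
    ∑ k ∈ Finset.range (M * N + 1), gridWeight c K N m (Pi.single k 1) * w k
      = gridWeight c K N m w := by
  have hmN : (m + 1) * N ≤ M * N := Nat.mul_le_mul_right _ hm
  have hmN' : (m + 1) * N = m * N + N := by ring
  have key : ∀ i, i < M * N + 1 →
      ∑ k ∈ Finset.range (M * N + 1), (Pi.single k (1 : ℝ) : ℕ → ℝ) i * w k = w i := by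
    intro i hi
    simp only [Pi.single_apply, ite_mul, one_mul, zero_mul]
    rw [Finset.sum_ite_eq, if_pos (Finset.mem_range.2 hi)]
  have hS : ∑ k ∈ Finset.range (M * N + 1),
      (∑ j ∈ Finset.range N, (Pi.single k (1 : ℝ) : ℕ → ℝ) (m * N + j + 1)) * w k
      = ∑ j ∈ Finset.range N, w (m * N + j + 1) := by
    simp only [Finset.sum_mul]
    rw [Finset.sum_comm]
    refine Finset.sum_congr rfl fun j hj => key _ ?_
    have := Finset.mem_range.1 hj
    omega
  calc _ = ∑ k ∈ Finset.range (M * N + 1),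
        (c * ((Pi.single k (1 : ℝ) : ℕ → ℝ) ((m + 1) * N) * w k
            + (Pi.single k (1 : ℝ) : ℕ → ℝ) (m * N) * w k)
          + K * (((∑ j ∈ Finset.range N, (Pi.single k (1 : ℝ) : ℕ → ℝ) (m * N + j + 1)) * w k)
            / N)) := Finset.sum_congr rfl fun k _ => by unfold gridWeight; ring
    _ = _ := by
      rw [Finset.sum_add_distrib, ← Finset.mul_sum, ← Finset.mul_sum, Finset.sum_add_distrib,
        ← Finset.sum_div, hS, key _ (by omega), key _ (by omega)]
      rfl

lemma gridWeight_nonneg {c K : ℝ} (hc : 0 ≤ c) (hK : 0 ≤ K) (N m : ℕ) {w : ℕ → ℝ}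
    (hw : ∀ k, 0 ≤ w k) : 0 ≤ gridWeight c K N m w := by
  unfold gridWeight
  have := Finset.sum_nonneg fun j (_ : j ∈ Finset.range N) => hw (m * N + j + 1)
  have h1 := hw ((m + 1) * N)
  have h2 := hw (m * N)
  positivity

variable {X : Type*} [MetricSpace X] [SecondCountableTopology X] [MeasurableSpace X]
  [BorelSpace X] {Ω : Type*} [mΩ : MeasurableSpace Ω]
  {P : ℝ≥0 → Kernel X X} {Φ : ℝ≥0 → Ω → X} {θ : ℝ≥0 → Ω → Ω} {Pr : X → Measure Ω} {γ : ℝ}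

/-- The increment over `[n - 1, n]`, with its integral replaced by a Riemann sum over the grid
of mesh `1 / N`, as a function of the positions at the grid points. -/
noncomputable def gridIncrement (χ g : X → ℝ) (N n : ℕ) (u : ℕ → X) : ℝ :=
  χ (u (n * N)) - χ (u ((n - 1) * N))
    + (∑ j ∈ Finset.range N, g (u ((n - 1) * N + j + 1))) / N

lemma abs_gridIncrement_sub_le {χ g : X → ℝ} {c K : ℝ}
    (hχ : ∀ u v, |χ u - χ v| ≤ c * dist u v) (hg : ∀ u v, |g u - g v| ≤ K * dist u v)
    (N m : ℕ) (u v : ℕ → X) :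
    |gridIncrement χ g N (m + 1) u - gridIncrement χ g N (m + 1) v|
      ≤ gridWeight c K N m fun k => dist (u k) (v k) := by
  have h3 : |(∑ j ∈ Finset.range N, g (u (m * N + j + 1))) / N
      - (∑ j ∈ Finset.range N, g (v (m * N + j + 1))) / N|
      ≤ K * ((∑ j ∈ Finset.range N, dist (u (m * N + j + 1)) (v (m * N + j + 1))) / N) := by
    rw [← sub_div, ← Finset.sum_sub_distrib, abs_div, Nat.abs_cast, ← mul_div_assoc,
      Finset.mul_sum]
    gcongr
    exact (Finset.abs_sum_le_sum_abs _ _).trans (Finset.sum_le_sum fun j _ => hg _ _)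
  have h1 := hχ (u ((m + 1) * N)) (v ((m + 1) * N))
  have h2 := hχ (u (m * N)) (v (m * N))
  simp only [gridIncrement, gridWeight, Nat.add_sub_cancel]
  rw [abs_le] at *
  constructor <;> linarith [h1.1, h1.2, h2.1, h2.2, h3.1, h3.2]

lemma IsProgMarkovProcess.measurable_increment (hΦ : IsProgMarkovProcess P Φ θ Pr)
    {g : X → ℝ} (hg : Measurable g) (hχ : Measurable (corrector P g)) (n : ℕ) :
    Measurable (increment P Φ g n) := by
  have hi : Measurable fun ω => ∫ s in ((n : ℝ) - 1)..(n : ℝ), g (Φ s.toNNReal ω) := by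
    simp only [intervalIntegral.integral_of_le (sub_le_self (n : ℝ) zero_le_one)]
    exact ((hΦ.measurable_comp hg measurable_real_toNNReal).stronglyMeasurable.integral_prod_left'
      (μ := volume.restrict (Set.Ioc ((n : ℝ) - 1) n))).measurable
  exact ((hχ.comp (hΦ.measurable _)).sub (hχ.comp (hΦ.measurable _))).add hi

/-- Expectations of `ℓ¹`-Lipschitz functionals of the increments are Lipschitz in the starting
point, uniformly in the number of increments involved. -/
lemma IsProgMarkovProcess.abs_integral_increments_sub_le (hP : IsMarkovSemigroup P)
    (hΦ : IsProgMarkovProcess P Φ θ Pr) (hA1 : StochasticallyContinuous P) (hγ0 : 0 < γ)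
    (hγ : ∀ (t : ℝ≥0) (x y : X),
      wassersteinDist (P t x) (P t y) ≤ ENNReal.ofReal (Real.exp (-γ * t) * dist x y))
    {g : X → ℝ} {c K B : ℝ} (hK : 0 ≤ K) (hg : ∀ u v, |g u - g v| ≤ K * dist u v)
    (hB : ∀ u, |g u| ≤ B) (hc : 0 ≤ c)
    (hχ : ∀ u v, |corrector P g u - corrector P g v| ≤ c * dist u v)
    {F : (ℕ → ℝ) → ℝ} {A C : ℝ} {M : ℕ} (hC : 0 ≤ C) (hA : ∀ z, |F z| ≤ A)
    (hF : ∀ z z', |F z - F z'| ≤ C * ∑ m ∈ Finset.range M, |z (m + 1) - z' (m + 1)|) (x y : X) :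
    |(∫ ω, F (fun n => increment P Φ g n ω) ∂(Pr x))
      - ∫ ω, F (fun n => increment P Φ g n ω) ∂(Pr y)|
      ≤ C * ((2 * c + K) * (1 - Real.exp (-γ))⁻¹) * dist x y := by
  have hprob := hΦ.prob
  have hgc : Continuous g := (LipschitzWith.of_dist_le_mul (K := ⟨K, hK⟩) hg).continuous
  have hχc : Continuous (corrector P g) :=
    (LipschitzWith.of_dist_le_mul (K := ⟨c, hc⟩) hχ).continuous
  have hFm : Measurable F := measurable_of_abs_sub_le (fun v => by fun_prop) (fun v => by simp) hF
  have hzm : Measurable fun ω n => increment P Φ g n ω :=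
    measurable_pi_lambda _ fun n => hΦ.measurable_increment hgc.measurable hχc.measurable n
  set r := Real.exp (-γ) with hr
  have hr1 : r < 1 := (Real.exp_lt_exp.2 (neg_lt_zero.2 hγ0)).trans_eq Real.exp_zero
  have hr0 : 0 ≤ r := Real.exp_nonneg _
  set t : ℕ → ℕ → ℝ≥0 := fun N k => (k : ℝ≥0) / N with ht
  set G : ℕ → Ω → ℕ → ℝ := fun N ω n =>
    gridIncrement (corrector P g) g N n (fun k => Φ (t N k) ω) with hG
  have hGm : ∀ N n, Measurable fun ω => G N ω n := by
    intro N n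
    have h1 : ∀ k, Measurable fun ω => corrector P g (Φ (t N k) ω) := fun k =>
      hχc.measurable.comp (hΦ.measurable _)
    have h2 : ∀ k, Measurable fun ω => g (Φ (t N k) ω) := fun k =>
      hgc.measurable.comp (hΦ.measurable _)
    exact ((h1 _).sub (h1 _)).add ((Finset.measurable_fun_sum _ fun j _ => h2 _).div_const _)
  have hlip : ∀ N, 0 < N → |(∫ ω, F (G N ω) ∂(Pr x)) - ∫ ω, F (G N ω) ∂(Pr y)|
      ≤ C * ((2 * c + K) * (1 - r)⁻¹) * dist x y := by
    intro N hN
    have hN' : (0 : ℝ) < N := by exact_mod_cast hN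
    have hweight : ∀ w : ℕ → ℝ, ∑ k ∈ Finset.range (M * N + 1),
        (C * ∑ m ∈ Finset.range M, gridWeight c K N m (Pi.single k 1)) * w k
        = C * ∑ m ∈ Finset.range M, gridWeight c K N m w := by
      intro w
      simp only [mul_assoc, ← Finset.mul_sum, Finset.sum_mul]
      rw [Finset.sum_comm]
      congr 1
      exact Finset.sum_congr rfl fun m hm => sum_gridWeight_single c K (Finset.mem_range.1 hm) w
    have hpath := hΦ.abs_integral_path_sub_le hP hγ (t := t N)
      (fun i j hij => by simp only [ht]; gcongr) (by simp [ht]) x y (B := A) (M * N)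
      (H := fun u => F fun n => gridIncrement (corrector P g) g N n u)
      (l := fun k => C * ∑ m ∈ Finset.range M, gridWeight c K N m (Pi.single k 1))
      (fun k => mul_nonneg hC (Finset.sum_nonneg fun m _ => gridWeight_nonneg hc hK N m fun i => by
        rw [Pi.single_apply]; positivity))
      (fun u => hA _) (fun u v => by
        rw [hweight fun k => dist (u k) (v k)]
        refine (hF _ _).trans (mul_le_mul_of_nonneg_left (Finset.sum_le_sum fun m _ => ?_) hC)
        exact abs_gridIncrement_sub_le hχ hg N m u v)
    refine hpath.trans (mul_le_mul_of_nonneg_right ?_ dist_nonneg)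
    rw [hweight fun k => Real.exp (-γ * t N k)]
    refine mul_le_mul_of_nonneg_left ?_ hC
    calc ∑ m ∈ Finset.range M, gridWeight c K N m (fun k => Real.exp (-γ * t N k))
        ≤ ∑ m ∈ Finset.range M, (2 * c + K) * r ^ m := by
          refine Finset.sum_le_sum fun m _ => ?_
          -- Every grid time entering the increment over `[m, m + 1]` is at least `m`, so each
          -- damping factor is at most `r ^ m`, while the total weight is `2 * c + K`.
          rw [← gridWeight_const hN m]
          refine gridWeight_mono hc hK N m fun k hk => ?_
          rw [hr, ← Real.exp_nat_mul]
          refine Real.exp_le_exp.2 ?_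
          have : (m : ℝ) ≤ t N k := by
            simp only [ht]
            push_cast
            rw [le_div_iff₀ hN']
            exact_mod_cast hk
          nlinarith
      _ = (2 * c + K) * ∑ m ∈ Finset.range M, r ^ m := (Finset.mul_sum _ _ _).symm
      _ ≤ (2 * c + K) * (1 - r)⁻¹ := by
          refine mul_le_mul_of_nonneg_left ?_ (by positivity)
          rw [← tsum_geometric_of_lt_one hr0 hr1]
          exact (summable_geometric_of_lt_one hr0 hr1).sum_le_tsum _ fun i _ => by positivity
  have hlim : ∀ x, Tendsto (fun N => ∫ ω, F (G N ω) ∂(Pr x)) atTop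
      (𝓝 (∫ ω, F (fun n => increment P Φ g n ω) ∂(Pr x))) := by
    intro x
    rw [tendsto_iff_norm_sub_tendsto_zero]
    set R : ℕ → ℕ → Ω → ℝ := fun m N ω =>
      |(∑ j ∈ Finset.range N, g (Φ (((m * N + j + 1 : ℕ) : ℝ≥0) / N) ω)) / N
        - ∫ s in (m : ℝ)..(m + 1), g (Φ s.toNNReal ω)| with hR
    have hRlim : Tendsto (fun N : ℕ => C * ∑ m ∈ Finset.range M, ∫ ω, R m N ω ∂(Pr x)) atTop
        (𝓝 0) := by
      simpa [hR] using (tendsto_finsetSum (Finset.range M) fun m _ =>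
        hΦ.tendsto_riemannSum hP hA1 hgc hB x m).const_mul C
    refine squeeze_zero' (Eventually.of_forall fun _ => norm_nonneg _) ?_ hRlim
    filter_upwards [eventually_gt_atTop 0] with N hN
    have hN' : (N : ℝ≥0) ≠ 0 := by exact_mod_cast hN.ne'
    -- Integer times are grid points, so the corrector terms agree exactly and only the Riemann
    -- error remains.
    have hdiff : ∀ m ω, |G N ω (m + 1) - increment P Φ g (m + 1) ω| = R m N ω := by
      intro m ω
      have e1 : t N ((m + 1) * N) = ((m + 1 : ℕ) : ℝ≥0) := by
        simp only [ht]; push_cast; field_simp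
      have e2 : t N (m * N) = (m : ℝ≥0) := by
        simp only [ht]; push_cast; field_simp
      simp only [hG, hR, gridIncrement, increment, Nat.add_sub_cancel, e1, e2]
      simp only [ht, Nat.cast_add, Nat.cast_one, add_sub_cancel_right]
      congr 1
      ring
    have hRm : ∀ m, Measurable (R m N) := fun m => by
      have := ((hGm N (m + 1)).sub
        (hΦ.measurable_increment hgc.measurable hχc.measurable (m + 1))).abs
      simpa only [Pi.sub_apply, hdiff] using this
    have hRi : ∀ m, Integrable (R m N) (Pr x) := by
      intro m
      refine .of_bound (hRm m).aestronglyMeasurable (B + B) (ae_of_all _ fun ω => ?_)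
      rw [hR, Real.norm_eq_abs, abs_abs]
      refine (abs_sub _ _).trans (add_le_add ?_ ?_)
      · have hNpos : (0 : ℝ) < N := by exact_mod_cast hN
        rw [abs_div, Nat.abs_cast, div_le_iff₀ hNpos]
        refine (Finset.abs_sum_le_sum_abs _ _).trans
          ((Finset.sum_le_sum fun j _ => hB _).trans_eq ?_)
        simp [mul_comm]
      · have := intervalIntegral.norm_integral_le_of_norm_le_const (a := (m : ℝ)) (b := m + 1)
          (f := fun s => g (Φ s.toNNReal ω)) (C := B) fun s _ => hB _
        simpa using this
    have hFi : ∀ {z : Ω → ℕ → ℝ}, Measurable z → Integrable (fun ω => F (z ω)) (Pr x) := fun hz =>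
      .of_bound (hFm.comp hz).aestronglyMeasurable A (ae_of_all _ fun _ => hA _)
    rw [← integral_sub (hFi (measurable_pi_lambda _ fun n => hGm N n)) (hFi hzm),
      ← integral_finsetSum _ fun m _ => hRi m, ← integral_const_mul]
    refine norm_integral_le_of_norm_le ((integrable_finsetSum _ fun m _ => hRi m).const_mul C)
      (ae_of_all _ fun ω => ?_)
    simp only [← hdiff]
    exact hF _ _
  refine le_of_tendsto ((hlim x).sub (hlim y)).abs ?_
  filter_upwards [eventually_gt_atTop 0] with N hN using hlip N hN

end Increments

/-! ### The functional is Lipschitz for the `ℓ¹` distance -/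

section Functional

/-- `L ↦ (√L + δ)²` on `[0, ∞]`. -/
noncomputable def sqrtShift (δ L : ℝ≥0∞) : ℝ≥0∞ := (L ^ (1 / 2 : ℝ) + δ) ^ (2 : ℝ)

lemma sqrtShift_mono (δ : ℝ≥0∞) : Monotone (sqrtShift δ) := fun a b h => by
  unfold sqrtShift; gcongr

lemma sqrtShift_top (δ : ℝ≥0∞) : sqrtShift δ ∞ = ∞ := by
  simp [sqrtShift]

lemma finset_inf_le_sqrtShift {δ : ℝ≥0∞} {A A' : ℕ → ℝ≥0∞} (s : Finset ℕ)
    (h : ∀ j ∈ s, A j ≤ sqrtShift δ (A' j)) : s.inf A ≤ sqrtShift δ (s.inf A') := by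
  induction s using Finset.induction_on with
  | empty => simp [sqrtShift_top]
  | insert a s ha ih =>
    rw [Finset.inf_insert, Finset.inf_insert, (sqrtShift_mono δ).map_inf]
    exact inf_le_inf (h a (Finset.mem_insert_self a s))
      (ih fun j hj => h j (Finset.mem_insert_of_mem hj))

lemma finset_sup_le_sqrtShift {δ : ℝ≥0∞} {A A' : ℕ → ℝ≥0∞} (s : Finset ℕ)
    (h : ∀ j ∈ s, A j ≤ sqrtShift δ (A' j)) : s.sup A ≤ sqrtShift δ (s.sup A') :=
  Finset.sup_le fun j hj => (h j hj).trans (sqrtShift_mono δ (Finset.le_sup hj))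

/-- Capping `L` at `d + 1` loses nothing, since the truncated distance equals `1` from there on. It
removes the value `∞`. -/
lemma truncDist_eq {d : ℝ} (hd : 0 ≤ d) (L : ℝ≥0∞) :
    truncDist L d = min |(min L (ENNReal.ofReal (d + 1))).toReal - d| 1 := by
  have hd1 : 0 ≤ d + 1 := by linarith
  unfold truncDist
  split_ifs with h
  · simp [h, ENNReal.toReal_ofReal hd1]
  · rcases le_total L (ENNReal.ofReal (d + 1)) with hL | hL
    · rw [min_eq_left hL]
    · rw [min_eq_right hL, ENNReal.toReal_ofReal hd1]
      have : d + 1 ≤ L.toReal := (ENNReal.ofReal_le_iff_le_toReal h).1 hL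
      rw [min_eq_right, min_eq_right]
      · simp
      · exact le_abs.2 (Or.inl (by linarith))

lemma truncDist_mem_Icc (L : ℝ≥0∞) (d : ℝ) : truncDist L d ∈ Set.Icc (0 : ℝ) 1 := by
  unfold truncDist
  split_ifs
  · simp
  · exact ⟨by positivity, min_le_right _ _⟩

lemma continuous_truncDist {d : ℝ} (hd : 0 ≤ d) : Continuous fun L => truncDist L d := by
  simp only [truncDist_eq hd]
  have h : Continuous fun L : ℝ≥0∞ => (min L (ENNReal.ofReal (d + 1))).toReal :=
    continuous_iff_continuousAt.2 fun L =>
      (ENNReal.tendsto_toReal (ne_top_of_le_ne_top ENNReal.ofReal_ne_top (min_le_right _ _))).comp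
        (continuous_id.min continuous_const).continuousAt
  fun_prop

lemma sqrt_toReal_min_le {δ b : ℝ} (hδ : 0 ≤ δ) (hb : 0 ≤ b) {L L' : ℝ≥0∞}
    (h : L ≤ sqrtShift (ENNReal.ofReal δ) L') :
    √(min L (ENNReal.ofReal b)).toReal ≤ √(min L' (ENNReal.ofReal b)).toReal + δ := by
  rcases le_total L' (ENNReal.ofReal b) with hL' | hL'
  · rw [min_eq_left hL']
    have hfin : L' ≠ ∞ := ne_top_of_le_ne_top ENNReal.ofReal_ne_top hL'
    have : (min L (ENNReal.ofReal b)).toReal ≤ (√L'.toReal + δ) ^ 2 := by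
      refine (ENNReal.toReal_mono ?_ ((min_le_left _ _).trans h)).trans_eq ?_
      · unfold sqrtShift; finiteness
      · rw [sqrtShift, ← ENNReal.toReal_rpow, ENNReal.toReal_add (by finiteness) (by finiteness),
          ← ENNReal.toReal_rpow, ENNReal.toReal_ofReal hδ, Real.sqrt_eq_rpow, Real.rpow_two]
    exact Real.sqrt_le_iff.2 ⟨by positivity, this⟩
  · rw [min_eq_right hL', ENNReal.toReal_ofReal hb]
    refine (Real.sqrt_le_sqrt ?_).trans (le_add_of_nonneg_right hδ)
    exact ENNReal.toReal_le_of_le_ofReal hb (min_le_right _ _)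

lemma abs_truncDist_sub_le {d δ : ℝ} (hd : 0 ≤ d) (hδ : 0 ≤ δ) {L L' : ℝ≥0∞}
    (h : L ≤ sqrtShift (ENNReal.ofReal δ) L') (h' : L' ≤ sqrtShift (ENNReal.ofReal δ) L) :
    |truncDist L d - truncDist L' d| ≤ 2 * √(d + 1) * δ := by
  have hb : 0 ≤ d + 1 := by linarith
  have h1 := sqrt_toReal_min_le hδ hb h
  have h2 := sqrt_toReal_min_le hδ hb h'
  rw [truncDist_eq hd, truncDist_eq hd]
  have hle : ∀ L : ℝ≥0∞, √(min L (ENNReal.ofReal (d + 1))).toReal ≤ √(d + 1) := fun L =>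
    Real.sqrt_le_sqrt (ENNReal.toReal_le_of_le_ofReal hb (min_le_right _ _))
  have h3 := hle L
  have h4 := hle L'
  set a := (min L (ENNReal.ofReal (d + 1))).toReal with ha
  set a' := (min L' (ENNReal.ofReal (d + 1))).toReal with ha'
  -- Both roots are at most `√(d + 1)` and they differ by at most `δ`, whence the constant `2 * √(d
  -- + 1)`.
  have hsq : a - a' = (√a + √a') * (√a - √a') := by
    have e1 := Real.mul_self_sqrt (show 0 ≤ a from ENNReal.toReal_nonneg)
    have e2 := Real.mul_self_sqrt (show 0 ≤ a' from ENNReal.toReal_nonneg)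
    linear_combination -e1 + e2
  have hmain : |a - a'| ≤ 2 * √(d + 1) * δ := by
    rw [hsq, abs_mul, abs_of_nonneg (by positivity : 0 ≤ √a + √a')]
    refine mul_le_mul (by linarith) (abs_le.2 ⟨by linarith, by linarith⟩) (abs_nonneg _)
      (by positivity)
  refine (abs_min_sub_min_le_max _ _ _ _).trans ?_
  rw [sub_self, abs_zero, max_eq_left (abs_nonneg _)]
  refine (abs_abs_sub_abs_le_abs_sub _ _).trans ?_
  rwa [sub_sub_sub_cancel_right]

/-- The average `(1/n) ∑_{k=1}^n (z_{2k+i}² ∧ p)`. -/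
noncomputable def seqAverage (i : ℕ) (p : ℕ∞) (n : ℕ) (z : ℕ → ℝ) : ℝ≥0∞ :=
  (∑ k ∈ Finset.Icc 1 n, min (ENNReal.ofReal (z (2 * k + i) ^ 2)) (p : ℝ≥0∞)) / n

lemma rpow_half_min (p : ℕ∞) (a : ℝ) :
    (min (ENNReal.ofReal (a ^ 2)) (p : ℝ≥0∞)) ^ (1 / 2 : ℝ)
      = min (ENNReal.ofReal |a|) ((p : ℝ≥0∞) ^ (1 / 2 : ℝ)) := by
  rw [(ENNReal.monotone_rpow_of_nonneg (by norm_num : (0 : ℝ) ≤ 1 / 2)).map_min,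
    ENNReal.ofReal_rpow_of_nonneg (sq_nonneg a) (by norm_num), ← Real.sqrt_eq_rpow,
    Real.sqrt_sq_eq_abs]

/-- The square root of `a² ∧ p` is `|a| ∧ √p`, which is 1-Lipschitz in `a` for every `p`, including
`∞`. -/
lemma rpow_half_min_le (p : ℕ∞) (a b : ℝ) :
    (min (ENNReal.ofReal (a ^ 2)) (p : ℝ≥0∞)) ^ (1 / 2 : ℝ)
      ≤ (min (ENNReal.ofReal (b ^ 2)) (p : ℝ≥0∞)) ^ (1 / 2 : ℝ) + ENNReal.ofReal |a - b| := by
  rw [rpow_half_min, rpow_half_min, min_add]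
  refine min_le_min ?_ le_self_add
  rw [← ENNReal.ofReal_add (abs_nonneg _) (abs_nonneg _)]
  refine ENNReal.ofReal_le_ofReal ?_
  have := abs_add_le b (a - b)
  rwa [add_sub_cancel] at this

/-- Minkowski's inequality for the averages. -/
lemma seqAverage_le_sqrtShift (i : ℕ) (p : ℕ∞) {n M : ℕ} (hM : 2 * n + i ≤ M) (z z' : ℕ → ℝ) :
    seqAverage i p n z ≤ sqrtShift
      (ENNReal.ofReal (∑ m ∈ Finset.range M, |z (m + 1) - z' (m + 1)|)) (seqAverage i p n z') := by
  set δ := ENNReal.ofReal (∑ m ∈ Finset.range M, |z (m + 1) - z' (m + 1)|) with hδ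
  rcases Nat.eq_zero_or_pos n with rfl | hn
  · simp [seqAverage]
  set f : (ℕ → ℝ) → ℕ → ℝ≥0∞ := fun z k =>
    (min (ENNReal.ofReal (z (2 * k + i) ^ 2)) (p : ℝ≥0∞)) ^ (1 / 2 : ℝ) with hf
  have hsq : ∀ z, seqAverage i p n z = (∑ k ∈ Finset.Icc 1 n, f z k ^ (2 : ℝ)) / n := by
    intro z
    simp only [seqAverage, hf, ← ENNReal.rpow_mul]
    norm_num
  set e : ℕ → ℝ≥0∞ := fun k => ENNReal.ofReal |z (2 * k + i) - z' (2 * k + i)| with he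
  have h1 : (∑ k ∈ Finset.Icc 1 n, f z k ^ (2 : ℝ)) ^ (1 / 2 : ℝ)
      ≤ (∑ k ∈ Finset.Icc 1 n, f z' k ^ (2 : ℝ)) ^ (1 / 2 : ℝ)
        + (∑ k ∈ Finset.Icc 1 n, e k ^ (2 : ℝ)) ^ (1 / 2 : ℝ) := by
    refine le_trans ?_ (ENNReal.Lp_add_le _ _ _ one_le_two)
    gcongr with k hk
    exact rpow_half_min_le p _ _
  -- The `ℓ²` norm is at most the `ℓ¹` norm.
  have h2 : (∑ k ∈ Finset.Icc 1 n, e k ^ (2 : ℝ)) ^ (1 / 2 : ℝ) ≤ ∑ k ∈ Finset.Icc 1 n, e k := by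
    rw [one_div, ENNReal.rpow_inv_le_iff two_pos, ENNReal.rpow_two, sq, Finset.sum_mul]
    simp only [ENNReal.rpow_two, sq]
    gcongr with k hk
    exact Finset.single_le_sum (f := e) (fun _ _ => zero_le) hk
  have h3 : ∑ k ∈ Finset.Icc 1 n, e k ≤ δ := by
    rw [hδ, he, ← ENNReal.ofReal_sum_of_nonneg fun _ _ => abs_nonneg _]
    refine ENNReal.ofReal_le_ofReal ?_
    have hinj : Set.InjOn (fun k => 2 * k + i - 1) (Finset.Icc 1 n : Finset ℕ) := by
      intro k hk l hl h
      simp only [Finset.coe_Icc, Set.mem_Icc] at hk hl h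
      omega
    calc ∑ k ∈ Finset.Icc 1 n, |z (2 * k + i) - z' (2 * k + i)|
        = ∑ m ∈ (Finset.Icc 1 n).image fun k => 2 * k + i - 1, |z (m + 1) - z' (m + 1)| := by
          rw [Finset.sum_image hinj]
          refine Finset.sum_congr rfl fun k hk => ?_
          have := (Finset.mem_Icc.1 hk).1
          rw [Nat.sub_add_cancel (by omega)]
      _ ≤ _ := by
          refine Finset.sum_le_sum_of_subset_of_nonneg (fun m hm => ?_) fun _ _ _ => abs_nonneg _
          obtain ⟨k, hk, rfl⟩ := Finset.mem_image.1 hm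
          have := Finset.mem_Icc.1 hk
          exact Finset.mem_range.2 (by omega)
  -- The averaging would even divide the error by `√n`. This gain is discarded to keep the bound
  -- uniform in `n`.
  have hn1 : (1 : ℝ≥0∞) ≤ (n : ℝ≥0∞) ^ (1 / 2 : ℝ) :=
    ENNReal.one_le_rpow (by exact_mod_cast hn) (by norm_num)
  rw [sqrtShift, ← ENNReal.rpow_inv_le_iff two_pos, ← one_div, hsq, hsq,
    ENNReal.div_rpow_of_nonneg _ _ (by norm_num), ENNReal.div_rpow_of_nonneg _ _ (by norm_num)]
  refine (ENNReal.div_le_div_right (h1.trans (add_le_add_right (h2.trans h3) _)) _).trans ?_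
  rw [ENNReal.add_div]
  gcongr
  exact ENNReal.div_le_of_le_mul (le_mul_of_one_le_right' hn1)

lemma tendsto_finset_inf_range (v : ℕ → ℝ≥0∞) :
    Tendsto (fun N => (Finset.range N).inf v) atTop (𝓝 (⨅ j, v j)) := by
  have h : ⨅ j, v j = ⨅ N, (Finset.range N).inf v :=
    le_antisymm (le_iInf fun N => Finset.le_inf fun j _ => iInf_le v j)
      (le_iInf fun j => (iInf_le _ (j + 1)).trans (Finset.inf_le (Finset.self_mem_range_succ j)))
  rw [h]
  exact tendsto_atTop_iInf fun N M hNM => Finset.inf_mono (Finset.range_mono hNM)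

lemma tendsto_finset_sup_range (v : ℕ → ℝ≥0∞) :
    Tendsto (fun N => (Finset.range N).sup v) atTop (𝓝 (⨆ j, v j)) := by
  have h : ⨆ j, v j = ⨆ N, (Finset.range N).sup v :=
    le_antisymm
      (iSup_le fun j => (Finset.le_sup (Finset.self_mem_range_succ j)).trans (le_iSup (fun N => (Finset.range N).sup v) (j + 1)))
      (iSup_le fun N => Finset.sup_le fun j _ => le_iSup v j)
  rw [h]
  exact tendsto_atTop_iSup fun N M hNM => Finset.sup_mono (Finset.range_mono hNM)

lemma tendsto_iInf_add_liminf (v : ℕ → ℝ≥0∞) :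
    Tendsto (fun m => ⨅ j, v (j + m)) atTop (𝓝 (liminf v atTop)) := by
  rw [liminf_eq_iSup_iInf_of_nat']
  refine tendsto_atTop_iSup fun m m' h => le_iInf fun j => (iInf_le _ (j + (m' - m))).trans_eq ?_
  congr 1
  omega

lemma tendsto_iSup_add_limsup (v : ℕ → ℝ≥0∞) :
    Tendsto (fun m => ⨆ j, v (j + m)) atTop (𝓝 (limsup v atTop)) := by
  rw [limsup_eq_iInf_iSup_of_nat']
  refine tendsto_atTop_iInf fun m m' h => iSup_le fun j => le_trans (le_of_eq ?_)
    (le_iSup (fun j => v (j + m)) (j + (m' - m)))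
  congr 1
  omega

end Functional

/-! ### Passage to the lower and upper limits -/

section Main

variable {X : Type*} [MetricSpace X] {Ω : Type*} [MeasurableSpace Ω] {Pr : X → Measure Ω}

lemma abs_integral_sub_le_of_tendsto (hprob : ∀ x, IsProbabilityMeasure (Pr x))
    {ψ : ℕ → Ω → ℝ} {ψ' : Ω → ℝ} {κ : ℝ} (hm : ∀ n, Measurable (ψ n)) (hb : ∀ n ω, |ψ n ω| ≤ 1)
    (hlim : ∀ ω, Tendsto (fun n => ψ n ω) atTop (𝓝 (ψ' ω))) (x y : X)
    (h : ∀ n, |(∫ ω, ψ n ω ∂(Pr x)) - ∫ ω, ψ n ω ∂(Pr y)| ≤ κ) :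
    |(∫ ω, ψ' ω ∂(Pr x)) - ∫ ω, ψ' ω ∂(Pr y)| ≤ κ := by
  have ht : ∀ x, Tendsto (fun n => ∫ ω, ψ n ω ∂(Pr x)) atTop (𝓝 (∫ ω, ψ' ω ∂(Pr x))) := fun x =>
    tendsto_integral_of_dominated_convergence (fun _ => 1) (fun n => (hm n).aestronglyMeasurable)
      (integrable_const _) (fun n => ae_of_all _ (hb n)) (ae_of_all _ hlim)
  exact le_of_tendsto' ((ht x).sub (ht y)).abs h

/-- The lower and the upper limit are treated together: `op` is the minimum or maximum over a
finite set, `opAll` the infimum or supremum over all indices, and `lim` the lower or upper limit. -/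
lemma abs_integral_truncDist_sub_le (hprob : ∀ x, IsProbabilityMeasure (Pr x))
    {Z : Ω → ℕ → ℝ} (hZ : Measurable Z) {κ : ℝ}
    (hκ : ∀ {F : (ℕ → ℝ) → ℝ} {A C : ℝ} {M : ℕ}, 0 ≤ C → (∀ z, |F z| ≤ A) →
      (∀ z z', |F z - F z'| ≤ C * ∑ m ∈ Finset.range M, |z (m + 1) - z' (m + 1)|) → ∀ x y,
      |(∫ ω, F (Z ω) ∂(Pr x)) - ∫ ω, F (Z ω) ∂(Pr y)| ≤ C * κ * dist x y)
    {d : ℝ} (hd : 0 ≤ d) (i : ℕ) (p : ℕ∞)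
    {op : Finset ℕ → (ℕ → ℝ≥0∞) → ℝ≥0∞} {opAll lim : (ℕ → ℝ≥0∞) → ℝ≥0∞}
    (hop : ∀ {δ : ℝ≥0∞} {A A' : ℕ → ℝ≥0∞} (s : Finset ℕ),
      (∀ j ∈ s, A j ≤ sqrtShift δ (A' j)) → op s A ≤ sqrtShift δ (op s A'))
    (hopAll : ∀ v, Tendsto (fun N => op (Finset.range N) v) atTop (𝓝 (opAll v)))
    (hlim : ∀ v, Tendsto (fun m => opAll fun j => v (j + m)) atTop (𝓝 (lim v))) (x y : X) :
    |(∫ ω, truncDist (lim fun n => seqAverage i p n (Z ω)) d ∂(Pr x))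
      - ∫ ω, truncDist (lim fun n => seqAverage i p n (Z ω)) d ∂(Pr y)|
      ≤ 2 * √(d + 1) * κ * dist x y := by
  have hcont := continuous_truncDist hd
  have hb : ∀ L, |truncDist L d| ≤ 1 := fun L => by
    rw [abs_of_nonneg (truncDist_mem_Icc L d).1]; exact (truncDist_mem_Icc L d).2
  -- The constant is independent of `m` and `N`. Only the number of increments involved grows, and
  -- `hκ` does not depend on it.
  have hF : ∀ m N : ℕ, ∀ z z' : ℕ → ℝ,
      |truncDist (op (Finset.range N) fun j => seqAverage i p (j + m) z) d
        - truncDist (op (Finset.range N) fun j => seqAverage i p (j + m) z') d|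
      ≤ 2 * √(d + 1) * ∑ k ∈ Finset.range (2 * (N + m) + i), |z (k + 1) - z' (k + 1)| := by
    intro m N z z'
    refine abs_truncDist_sub_le hd (Finset.sum_nonneg fun _ _ => abs_nonneg _)
      (hop _ fun j hj => ?_) (hop _ fun j hj => ?_)
    · have := Finset.mem_range.1 hj
      exact seqAverage_le_sqrtShift i p (by omega) z z'
    · have := Finset.mem_range.1 hj
      simp only [abs_sub_comm (z _) (z' _)]
      exact seqAverage_le_sqrtShift i p (by omega) z' z
  have hmeas : ∀ m N : ℕ, Measurable fun ω =>
      truncDist (op (Finset.range N) fun j => seqAverage i p (j + m) (Z ω)) d := fun m N =>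
    (measurable_of_abs_sub_le (fun v => by fun_prop) (fun v => by simp) (hF m N)).comp hZ
  have hinner : ∀ m ω, Tendsto (fun N => truncDist
      (op (Finset.range N) fun j => seqAverage i p (j + m) (Z ω)) d) atTop
      (𝓝 (truncDist (opAll fun j => seqAverage i p (j + m) (Z ω)) d)) := fun m ω =>
    (hcont.tendsto _).comp (hopAll _)
  -- The outer limit lets the tail index `m` grow; the inner one, below, lets the finite window of
  -- length `N` grow.
  refine abs_integral_sub_le_of_tendsto hprob
    (ψ := fun m ω => truncDist (opAll fun j => seqAverage i p (j + m) (Z ω)) d)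
    (fun m => measurable_of_tendsto_metrizable (hmeas m) (tendsto_pi_nhds.2 (hinner m)))
    (fun m ω => hb _) (fun ω => (hcont.tendsto _).comp (hlim _)) x y fun m => ?_
  exact abs_integral_sub_le_of_tendsto hprob (hmeas m) (fun N ω => hb _) (hinner m) x y fun N =>
    hκ (by positivity) (fun z => hb _) (hF m N) x y

lemma integral_truncDist_mem_Icc (ν : Measure Ω) [IsProbabilityMeasure ν] (L : Ω → ℝ≥0∞) (d : ℝ) :
    ∫ ω, truncDist (L ω) d ∂ν ∈ Set.Icc (0 : ℝ) 1 := by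
  refine ⟨integral_nonneg fun ω => (truncDist_mem_Icc _ _).1, (le_abs_self _).trans ?_⟩
  refine abs_integral_le_of_abs_le ν fun ω => ?_
  rw [abs_of_nonneg (truncDist_mem_Icc _ _).1]
  exact (truncDist_mem_Icc _ _).2

end Main

end MarkovLIL

open MarkovLIL in
theorem lemma3p5
    {X : Type*} [MetricSpace X] [CompleteSpace X] [SecondCountableTopology X]
    [MeasurableSpace X] [BorelSpace X]
    {Ω : Type*} [MeasurableSpace Ω]
    (P : ℝ≥0 → Kernel X X) (hP : IsMarkovSemigroup P)
    (Φ : ℝ≥0 → Ω → X) (θ : ℝ≥0 → Ω → Ω) (Pr : X → Measure Ω)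
    (hΦ : IsProgMarkovProcess P Φ θ Pr)
    (hA1 : StochasticallyContinuous P)
    (hA2 : Feller P)
    (hA3 : ExponentiallyMixing P)
    (μ : Measure X) [IsProbabilityMeasure μ] (hA4 : UniformlyBoundedMoment P μ)
    (μstar : Measure X) [IsProbabilityMeasure μstar] (hμstar : IsInvariant P μstar)
    (g : X → ℝ) (hg_lip : ∃ K : ℝ≥0, LipschitzWith K g) (hg_bdd : ∃ C : ℝ, ∀ x, |g x| ≤ C)
    (hg_mean : ∫ x, g x ∂μstar = 0)
    (p : ℕ∞) (d : ℝ) (hd : 0 ≤ d) (i : ℕ) (hi : i = 0 ∨ i = 1) :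
    ((∀ x, liminfFun P Φ Pr g i p d x ∈ Set.Icc (0 : ℝ) 1) ∧ Continuous (liminfFun P Φ Pr g i p d)) ∧
    ((∀ x, limsupFun P Φ Pr g i p d x ∈ Set.Icc (0 : ℝ) 1) ∧ Continuous (limsupFun P Φ Pr g i p d)) :=
  by
  obtain ⟨-, γ, hγ0, hγ⟩ := hA3
  obtain ⟨K, hK⟩ := hg_lip
  obtain ⟨B, hB⟩ := hg_bdd
  have hprob := hΦ.prob
  have hg : ∀ u v, |g u - g v| ≤ K * dist u v := fun u v => hK.dist_le_mul u v
  have hgm : Measurable g := hK.continuous.measurable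
  have hc : (0 : ℝ) ≤ K / γ := by positivity
  have hχ := abs_corrector_sub_le hP hγ0 hγ hμstar
    (integrable_dist_of_isInvariant hP hγ0 hγ hA4 hμstar) K.coe_nonneg hg hgm hB hg_mean
  have hχm : Measurable (corrector P g) :=
    (LipschitzWith.of_dist_le_mul (K := ⟨K / γ, hc⟩) hχ).continuous.measurable
  have hZ : Measurable fun ω n => increment P Φ g n ω :=
    measurable_pi_lambda _ fun n => hΦ.measurable_increment hgm hχm n
  set κ : ℝ := (2 * (K / γ) + K) * (1 - Real.exp (-γ))⁻¹ with hκdef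
  have hκ : 0 ≤ κ := by
    have : Real.exp (-γ) < 1 := (Real.exp_lt_exp.2 (neg_lt_zero.2 hγ0)).trans_eq Real.exp_zero
    have : 0 ≤ (1 - Real.exp (-γ))⁻¹ := inv_nonneg.2 (by linarith)
    positivity
  have hbase := fun {F : (ℕ → ℝ) → ℝ} {A C : ℝ} {M : ℕ} (hC : 0 ≤ C) (hA : ∀ z, |F z| ≤ A)
    (hF : ∀ z z', |F z - F z'| ≤ C * ∑ m ∈ Finset.range M, |z (m + 1) - z' (m + 1)|) (x y : X) =>
    hΦ.abs_integral_increments_sub_le hP hA1 hγ0 hγ K.coe_nonneg hg hB hc hχ hC hA hF x y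
  have hκ' : 0 ≤ 2 * √(d + 1) * κ := by positivity
  refine ⟨⟨fun x => integral_truncDist_mem_Icc _ _ _, ?_⟩,
    ⟨fun x => integral_truncDist_mem_Icc _ _ _, ?_⟩⟩
  · refine (LipschitzWith.of_dist_le_mul (K := ⟨_, hκ'⟩) fun x y => ?_).continuous
    exact abs_integral_truncDist_sub_le hprob hZ hbase hd i p finset_inf_le_sqrtShift
      tendsto_finset_inf_range tendsto_iInf_add_liminf x y
  · refine (LipschitzWith.of_dist_le_mul (K := ⟨_, hκ'⟩) fun x y => ?_).continuous
    exact abs_integral_truncDist_sub_le hprob hZ hbase hd i p finset_sup_le_sqrtShift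
      tendsto_finset_sup_range tendsto_iSup_add_limsup x y
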